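/- Let $(\Phi u)(\xi)=(2\pi)^{-1/2}\int_{\mathbb R}u(x)e^{-ix\xi}\,dx$ be the Fourier transform. Let $\mathcal Z$ be the set of Schwartz functions on $\mathbb R$ which extend to entire functions satisfying, for some $r>0$ and all $n$, $|\varphi(z)|\le C_n(1+|z|)^{-n}e^{r|\operatorname{Im}z|}$, $z\in\mathbb C$; thus $\Phi$ maps $\mathcal Z$ onto $C_0^\infty(\mathbb R)$. Let $\mathcal Z'$ and $C_0^\infty(\mathbb R)'$ be the corresponding spaces of continuous antilinear functionals. A bounded operator $H$ on $L^2(\mathbb R_+)$ is the Hankel operator with (distributional) kernel $h$, where $\theta(x)=e^xh(e^x)$ belongs to $\mathcal Z'$, if $$(Hf_1,f_2)=\langle\theta,\Omega\rangle,\qquad \Omega(x)=\int_0^{e^x}\overline{f_1(s)}f_2(e^x-s)\,ds,$$ for all $f_1,f_2$ such that $e^{x/2}f_j(e^x)\in\mathcal Z$ (then $\Omega\in\mathcal Z$); for ordinary functions $h$ this is $(Hf)(t)=\int_0^\infty h(t+s)f(s)\,ds$. Its sign-function is $s=\sqrt{2\pi}\,\Phi^*b\in\mathcal Z'$, where $b(\xi)=(2\pi)^{-1/2}\Gamma(1-i\xi)^{-1}(\Phi\theta)(\xi)\in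 C_0^\infty(\mathbb R)'$. For a bounded self-adjoint operator $A$, let $N_-(A)$ be the total multiplicity of its strictly negative spectrum. Let $H_0$ be a bounded Hankel operator on $L^2(\mathbb R_+)$ whose sign-function $s_0$ is a bounded non-negative function. Let $V$ be the finite rank Hankel operator $(Vf)(t)=\int_0^\infty v(t+s)f(s)\,ds$ on $L^2(\mathbb R_+)$ with the real kernel $$v(t)=\sum_{m=1}^{M_0}P_m(t)e^{-\alpha_mt}+\sum_{m=M_0+1}^{M_0+M_1}\Big(P_m(t)e^{-\alpha_mt}+\overline{P_m(t)}e^{-\overline{\alpha_m}t}\Big),$$ where $M_0,M_1\ge0$, the numbers $\alpha_1,\dots,\alpha_{M_0+M_1}$ are distinct, $\operatorname{Re}\alpha_m>0$, $P_m$ is a non-zero polynomial of degree $K_m$, $\alpha_m$ and $P_m$ are real for $m\le M_0$, and $\operatorname{Im}\alpha_m>0$ for $m>M_0$. For $m\le M_0$ put ${\sf p}_m=P_m^{(K_m)}$ and $$\mathcal N_-^{(m)}=\begin{cases}(K_m+1)/2,&K_m\text{ odd},\\ K_m/2,&K_m\text{ even},\ {\sf p}_m>0,\\ K_m/2+1,&K_m\text{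 even},\ {\sf p}_m<0.\end{cases}$$ Then $V$ and $H_0+V$ are self-adjoint, $$N_-(H_0+V)=\sum_{m=1}^{M_0}\mathcal N_-^{(m)}+\sum_{m=M_0+1}^{M_0+M_1}K_m+M_1,$$ and $N_-(H_0+V)=N_-(V)$. In particular, $H_0+V\ge0$ if and only if $V\ge0$. -/

import Mathlib

open MeasureTheory
open scoped ContDiff Distributions SchwartzMap InnerProductSpace

noncomputable section

namespace HankelSign

/-- The Hilbert space `L²(ℝ₊)` of complex-valued functions. -/
abbrev L2Plus : Type := Lp ℂ 2 (volume.restrict (Set.Ioi (0 : ℝ)))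

/-! ### The space `𝒵` of test functions and its dual -/

/-- `F` is an entire function with `|F(z)| ≤ Cₙ (1+|z|)⁻ⁿ e^{r|Im z|}` for all `n`. -/
def HasTypeBound (F : ℂ → ℂ) (r : ℝ) : Prop :=
  Differentiable ℂ F ∧
    ∀ n : ℕ, ∃ C : ℝ, ∀ z : ℂ, ‖F z‖ ≤ C * ((1 + ‖z‖) ^ n)⁻¹ * Real.exp (r * |z.im|)

theorem HasTypeBound.mono {F : ℂ → ℂ} {r r' : ℝ} (h : HasTypeBound F r) (hr : r ≤ r') :
    HasTypeBound F r' := by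
  refine ⟨h.1, fun n => ?_⟩
  obtain ⟨C, hC⟩ := h.2 n
  refine ⟨|C|, fun z => (hC z).trans ?_⟩
  gcongr
  exact le_abs_self C

/-- The space `𝒵` of Schwartz functions on `ℝ` that extend to entire functions on `ℂ` satisfying
`|φ(z)| ≤ Cₙ (1+|z|)⁻ⁿ e^{r|Im z|}` for some `r = r(φ) > 0` and all `n`. -/
def ZSpace : Submodule ℂ 𝓢(ℝ, ℂ) where
  carrier := {φ | ∃ F : ℂ → ℂ, (∀ x : ℝ, F x = φ x) ∧ ∃ r > 0, HasTypeBound F r}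
  zero_mem' := ⟨0, fun _ => rfl, 1, one_pos, differentiable_const 0,
    fun _ => ⟨0, fun _ => by simp⟩⟩
  add_mem' := by
    rintro φ ψ ⟨F, hF, r, hr, hFr⟩ ⟨G, hG, q, hq, hGq⟩
    have hF' := hFr.mono (le_max_left r q)
    have hG' := hGq.mono (le_max_right r q)
    refine ⟨fun z => F z + G z, fun x => by simp [hF, hG], max r q, lt_max_of_lt_left hr,
      hF'.1.add hG'.1, fun n => ?_⟩
    obtain ⟨C, hC⟩ := hF'.2 n
    obtain ⟨D, hD⟩ := hG'.2 n
    refine ⟨C + D, fun z => (norm_add_le _ _).trans ((add_le_add (hC z) (hD z)).trans ?_)⟩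
    rw [add_mul, add_mul]
  smul_mem' := by
    rintro c φ ⟨F, hF, r, hr, hFr⟩
    refine ⟨fun z => c * F z, fun x => by simp [hF], r, hr, hFr.1.const_mul c, fun n => ?_⟩
    obtain ⟨C, hC⟩ := hFr.2 n
    refine ⟨‖c‖ * C, fun z => ?_⟩
    rw [norm_mul, mul_assoc, mul_assoc, ← mul_assoc C]
    exact mul_le_mul_of_nonneg_left (hC z) (norm_nonneg c)

/-- The dual `𝒵'`: continuous antilinear functionals on `𝒵`. As `𝒵` is the inductive limit over
`r` of the Fréchet spaces of functions of type `r`, continuity says that on each of these the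
functional is bounded by a multiple of one of the norms
`sup_z (1+|z|)ⁿ e^{-r|Im z|} |F(z)|`. -/
structure ZDual where
  /-- the underlying antilinear functional -/
  toFun : ZSpace →ₗ⋆[ℂ] ℂ
  bound : ∀ r > 0, ∃ n : ℕ, ∃ C : ℝ, ∀ (φ : ZSpace) (F : ℂ → ℂ),
    (∀ x : ℝ, F x = (φ : 𝓢(ℝ, ℂ)) x) → HasTypeBound F r →
    ∀ B : ℝ, (∀ z : ℂ, (1 + ‖z‖) ^ n * Real.exp (-(r * |z.im|)) * ‖F z‖ ≤ B) →
      ‖toFun φ‖ ≤ C * B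

/-- The space `C₀^∞(ℝ)` with its usual topology. -/
abbrev CcInfty : Type := 𝓓((⊤ : TopologicalSpace.Opens ℝ), ℂ)

/-- The dual `C₀^∞(ℝ)'`: continuous antilinear functionals on `C₀^∞(ℝ)`. -/
abbrev CcDual : Type := CcInfty →L⋆[ℂ] ℂ

/-! ### Fourier transform, `b`-function and sign-function -/

/-- The Fourier transform `(Φu)(ξ) = (2π)^{-1/2} ∫ u(x) e^{-ixξ} dx`. -/
def fourierPhi (u : ℝ → ℂ) (ξ : ℝ) : ℂ :=
  (((2 * Real.pi) ^ (-(1 / 2) : ℝ) : ℝ) : ℂ) *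
    ∫ x : ℝ, u x * Complex.exp (-(Complex.I * x * ξ))

/-- `a = Φθ` for `θ ∈ 𝒵'`, `a ∈ C₀^∞(ℝ)'`: one has `⟨a, Φφ⟩ = ⟨θ, φ⟩`. (`Φ` is a bijection of
`𝒵` onto `C₀^∞(ℝ)`, and so of `𝒵'` onto `C₀^∞(ℝ)'`.) -/
def IsFourierOf (θ : ZDual) (a : CcDual) : Prop :=
  ∀ (φ : ZSpace) (g : CcInfty), (∀ ξ : ℝ, g ξ = fourierPhi (φ : 𝓢(ℝ, ℂ)) ξ) → a g = θ.toFun φ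

/-- `b(ξ) = (2π)^{-1/2} a(ξ) Γ(1-iξ)⁻¹`, a distribution multiplied by a smooth function. -/
def IsBFunctionOf (a b : CcDual) : Prop :=
  ∀ g k : CcInfty,
    (∀ ξ : ℝ, k ξ = (starRingEnd ℂ) (Complex.Gamma (1 - Complex.I * ξ))⁻¹ * g ξ) →
      b g = (((2 * Real.pi) ^ (-(1 / 2) : ℝ) : ℝ) : ℂ) * a k

/-- `s ∈ 𝒵'` is the sign-function of the kernel `h` with `θ(x) = e^x h(e^x)`: it is
`s = √(2π) Φ* b` with the `b`-function `b = (2π)^{-1/2} Γ(1-iξ)⁻¹ a` and `a = Φθ`. -/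
def IsSignFunctionOf (θ s : ZDual) : Prop :=
  ∃ a b : CcDual, IsFourierOf θ a ∧ IsBFunctionOf a b ∧
    IsFourierOf s (((Real.sqrt (2 * Real.pi) : ℝ) : ℂ) • b)

/-- The distribution `s ∈ 𝒵'` is a bounded positive function:
`⟨s, u⟩ = ∫ s₀(x) conj(u(x)) dx` with `0 ≤ s₀ ∈ L^∞(ℝ)`. -/
def IsBoundedPositive (s : ZDual) : Prop :=
  ∃ s₀ : ℝ → ℝ, AEMeasurable s₀ ∧ (∀ᵐ x, 0 ≤ s₀ x) ∧ (∃ C : ℝ, ∀ᵐ x, s₀ x ≤ C) ∧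
    ∀ u : ZSpace, s.toFun u = ∫ x : ℝ, (s₀ x : ℂ) * (starRingEnd ℂ) ((u : 𝓢(ℝ, ℂ)) x)

/-! ### Hankel operators -/

/-- `f(t) = t^{-1/2} φ(ln t)`, the inverse of `(Uf)(x) = e^{x/2} f(e^x)`. -/
def Uinv (φ : ℝ → ℂ) (t : ℝ) : ℂ := ((t ^ (-(1 / 2) : ℝ) : ℝ) : ℂ) * φ (Real.log t)

/-- The Laplace convolution `(f̄₁ ⋆ f₂)(t) = ∫₀ᵗ conj(f₁(s)) f₂(t-s) ds`. -/
def laplaceConv (f₁ f₂ : ℝ → ℂ) (t : ℝ) : ℂ :=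
  ∫ s in (0 : ℝ)..t, (starRingEnd ℂ) (f₁ s) * f₂ (t - s)

/-- The bounded operator `H` on `L²(ℝ₊)` is the Hankel operator with the (distributional) kernel
`h` given by `θ(x) = e^x h(e^x)`, `θ ∈ 𝒵'`: for all `f₁, f₂` with `U f₁, U f₂ ∈ 𝒵`,
`(H f₁, f₂) = ⟨h, f̄₁ ⋆ f₂⟩ = ⟨θ, Ω⟩` where `Ω(x) = (f̄₁ ⋆ f₂)(e^x)` (this is a function in `𝒵`).
The inner product `(·,·)` is linear in its first argument. -/
def IsHankelOperator (H : L2Plus →L[ℂ] L2Plus) (θ : ZDual) : Prop :=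
  ∀ (φ₁ φ₂ : ZSpace) (f₁ f₂ : L2Plus),
    f₁ =ᵐ[volume.restrict (Set.Ioi (0 : ℝ))] Uinv (φ₁ : 𝓢(ℝ, ℂ)) →
    f₂ =ᵐ[volume.restrict (Set.Ioi (0 : ℝ))] Uinv (φ₂ : 𝓢(ℝ, ℂ)) →
    ∀ Ω : ZSpace,
      (∀ x : ℝ, (Ω : 𝓢(ℝ, ℂ)) x =
        laplaceConv (Uinv (φ₁ : 𝓢(ℝ, ℂ))) (Uinv (φ₂ : 𝓢(ℝ, ℂ))) (Real.exp x)) →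
      ⟪f₂, H f₁⟫_ℂ = θ.toFun Ω

/-- `V` is the integral operator `(Vf)(t) = ∫₀^∞ v(t+s) f(s) ds` on `L²(ℝ₊)`. -/
def IsHankelIntegralOperator (V : L2Plus →L[ℂ] L2Plus) (v : ℝ → ℂ) : Prop :=
  ∀ f : L2Plus, ∀ᵐ t ∂(volume.restrict (Set.Ioi (0 : ℝ))),
    V f t = ∫ s in Set.Ioi (0 : ℝ), v (t + s) * f s

/-- The data of the kernel of a self-adjoint finite rank Hankel operator: `M₀` real exponents with
non-zero real polynomials, and `M₁` exponents in the open upper half-plane with non-zero complex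
polynomials, each standing for itself and its complex conjugate. All exponents are distinct and
have positive real parts. -/
structure FiniteRankKernel where
  M₀ : ℕ
  M₁ : ℕ
  α : Fin M₀ → ℝ
  P : Fin M₀ → Polynomial ℝ
  γ : Fin M₁ → ℂ
  Q : Fin M₁ → Polynomial ℂ
  α_pos : ∀ m, 0 < α m
  α_inj : Function.Injective α
  P_ne : ∀ m, P m ≠ 0
  γ_re : ∀ m, 0 < (γ m).re
  γ_im : ∀ m, 0 < (γ m).im
  γ_inj : Function.Injective γ
  Q_ne : ∀ m, Q m ≠ 0

/-- The kernel `v(t) = ∑ P_m(t) e^{-α_m t}`, the sum over the real exponents and over the pairs of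
complex conjugate ones. -/
def FiniteRankKernel.kernel (k : FiniteRankKernel) (t : ℝ) : ℂ :=
  (∑ m, (((k.P m).eval t : ℝ) : ℂ) * Complex.exp (-(k.α m * t))) +
    ∑ m, ((k.Q m).eval (t : ℂ) * Complex.exp (-(k.γ m * t)) +
      (starRingEnd ℂ) ((k.Q m).eval (t : ℂ)) *
        Complex.exp (-((starRingEnd ℂ) (k.γ m) * t)))

/-- The number `𝒩₋` of a non-zero real polynomial `P` of degree `K`, with `p = P^{(K)}`:
`(K+1)/2` if `K` is odd, `K/2` if `K` is even and `p > 0`, `K/2 + 1` if `K` is even and `p < 0`. -/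
def negNumber (P : Polynomial ℝ) : ℕ :=
  if Odd P.natDegree then (P.natDegree + 1) / 2
  else if 0 < ((P.natDegree.factorial : ℕ) : ℝ) * P.leadingCoeff then P.natDegree / 2
  else P.natDegree / 2 + 1

/-- `∑_{m=1}^{M₀} 𝒩₋^{(m)} + ∑_{m=M₀+1}^{M₀+M₁} K_m + M₁`. -/
def FiniteRankKernel.totalNeg (k : FiniteRankKernel) : ℕ :=
  (∑ m, negNumber (k.P m)) + (∑ m, (k.Q m).natDegree) + k.M₁

/-- The total multiplicity `N₋(A) ∈ {0, 1, …, ∞}` of the strictly negative spectrum of a bounded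
self-adjoint operator `A`, i.e. the dimension of its spectral subspace for `(-∞, 0)`. The range of
the negative part `A⁻ = max(-A, 0)` (functional calculus) is dense in that subspace. -/
def Nminus {E : Type*} [NormedAddCommGroup E] [InnerProductSpace ℂ E] [CompleteSpace E]
    (A : E →L[ℂ] E) : ℕ∞ :=
  Cardinal.toENat (Module.rank ℂ (LinearMap.range ((A⁻ : E →L[ℂ] E) : E →ₗ[ℂ] E)))

end HankelSign

end

/-!
Let `L` be the Laplace transform on `L²(ℝ₊)`, a bounded self-adjoint operator. For `f` with
`e^{x/2} f(e^x) = (Φ* g)(x)`, `g` a test function, the Mellin transform turns both quadratic forms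
into multiplications: with `γ(ξ) = Γ(1/2 + iξ) g(ξ)`,
`‖L f‖² = ∫ |Φ* γ|²` and `(H₀ f, f) = ∫ s₀ |Φ* γ|²`.
Such `f` are dense, so `0 ≤ H₀ ≤ C L²` if `0 ≤ s₀ ≤ C`.

The form of `V` is that of a matrix in the functionals `(f, t ^ a e^{-αt})`. For real `α` its
diagonal blocks are triangular with respect to the antidiagonal, and conjugate exponents are
coupled only with each other. This gives a subspace of codimension `N` on which `V ≥ 0`, where `N`
is the sum in the theorem, and likewise for `-V`; the two codimensions add up to the rank of `V`,
so `N₋(V) = N`.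

As `H₀ ≥ 0`, also `H₀ + V ≥ 0` on that subspace, hence `N₋(H₀ + V) ≤ N`. Conversely, no nonzero
exponential polynomial lies in the range of `L`, and therefore `L` maps `ker V` to a subspace
whose closure contains the range of `L`. Hence every vector of the negative subspace of `V` can be
modified by an element of `ker V` so that `L`, and with it the form of `H₀`, is arbitrarily small
on it; this keeps the form of `V` and gives `N₋(V) ≤ N₋(H₀ + V)`.
-/

namespace HankelSign

open scoped ComplexConjugate Polynomial

/-! ### The negative index of a self-adjoint operator -/

lemma exists_linearMap_norm_sub_le {𝕜 E G : Type*} [NontriviallyNormedField 𝕜] [CompleteSpace 𝕜]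
    [NormedAddCommGroup E] [NormedSpace 𝕜 E] [NormedAddCommGroup G] [NormedSpace 𝕜 G]
    {W K : Submodule 𝕜 E} [FiniteDimensional 𝕜 W] (T : E →L[𝕜] G)
    (hT : ∀ e, T e ∈ (K.map (T : E →ₗ[𝕜] G)).topologicalClosure)
    {ε : ℝ} (hε : 0 < ε) : ∃ κ : W →ₗ[𝕜] K, ∀ w, ‖T (w - κ w)‖ ≤ ε * ‖w‖ := by
  let b := Module.finBasis 𝕜 W
  let coords : W →L[𝕜] (Fin (Module.finrank 𝕜 W) → 𝕜) :=
    LinearMap.toContinuousLinearMap (b.equivFun : W →ₗ[𝕜] _)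
  obtain ⟨δ, hδ, hδε⟩ : ∃ δ > 0, Module.finrank 𝕜 W * ‖coords‖ * δ < ε :=
    exists_pos_mul_lt hε _
  have hnear (i) : ∃ y : K, ‖T (b i - y)‖ < δ := by
    obtain ⟨_, ⟨y, hy, rfl⟩, hlt⟩ := Metric.mem_closure_iff.1 (hT (b i)) δ hδ
    exact ⟨⟨y, hy⟩, by simpa [dist_eq_norm] using hlt⟩
  choose y hy using hnear
  refine ⟨b.constr 𝕜 y, fun w => ?_⟩
  have hsum : (w : E) - b.constr 𝕜 y w = ∑ i, coords w i • ((b i : E) - y i) := by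
    have hw := congrArg Subtype.val (b.sum_equivFun w)
    simp only [AddSubmonoidClass.coe_finsetSum, Submodule.coe_smul] at hw
    simp [smul_sub, Finset.sum_sub_distrib, Module.Basis.constr_apply_fintype, coords, ← hw]
  calc ‖T (w - b.constr 𝕜 y w)‖ = ‖∑ i, coords w i • T ((b i : E) - y i)‖ := by
        rw [hsum, map_sum]; simp only [map_smul]
    _ ≤ ∑ _i : Fin (Module.finrank 𝕜 W), ‖coords‖ * ‖w‖ * δ := by
        refine norm_sum_le_of_le _ fun i _ => ?_
        rw [norm_smul]
        gcongr
        exacts [(norm_le_pi_norm (coords w) i).trans (coords.le_opNorm w), (hy i).le]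
    _ = Module.finrank 𝕜 W * ‖coords‖ * δ * ‖w‖ := by
        rw [Finset.sum_const, Finset.card_univ, Fintype.card_fin, nsmul_eq_mul]; ring
    _ ≤ ε * ‖w‖ := by gcongr

section NegativeIndex

open ContinuousLinearMap (adjoint)

variable {E G : Type*} [NormedAddCommGroup E] [InnerProductSpace ℂ E] [CompleteSpace E]
  [NormedAddCommGroup G] [InnerProductSpace ℂ G] [CompleteSpace G]

lemma exists_re_inner_eq_norm_sq {B : E →L[ℂ] E} (hB : 0 ≤ B) :
    ∃ S : E →L[ℂ] E, B = star S * S ∧ ∀ f, (⟪f, B f⟫_ℂ).re = ‖S f‖ ^ 2 := by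
  obtain ⟨S, rfl⟩ := CStarAlgebra.nonneg_iff_eq_star_mul_self.1 hB
  exact ⟨S, rfl, fun f => (S.apply_norm_sq_eq_inner_adjoint_right f).symm⟩

lemma exists_mul_norm_sq_le_re_inner {B : E →L[ℂ] E} (hB : 0 ≤ B) (W : Submodule ℂ E)
    [FiniteDimensional ℂ W] (hW : ∀ f ∈ W, B f = 0 → f = 0) :
    ∃ c > 0, ∀ f ∈ W, c * ‖f‖ ^ 2 ≤ (⟪f, B f⟫_ℂ).re := by
  obtain ⟨S, rfl, hS⟩ := exists_re_inner_eq_norm_sq hB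
  have hker : LinearMap.ker ((S : E →ₗ[ℂ] E) ∘ₗ W.subtype) = ⊥ :=
    LinearMap.ker_eq_bot'.2 fun f (hf : S f = 0) => Subtype.ext <| hW f f.2 <| by
      rw [mul_apply_eq_comp, hf, map_zero]
  obtain ⟨K, hK, hKS⟩ := LinearMap.exists_antilipschitzWith _ hker
  refine ⟨((K : ℝ) ^ 2)⁻¹, by positivity, fun f hf => ?_⟩
  rw [hS, inv_mul_le_iff₀ (by positivity), ← mul_pow]
  gcongr
  exact ZeroHomClass.bound_of_antilipschitz _ hKS ⟨f, hf⟩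

variable {A V : E →L[ℂ] E}

lemma re_inner_eq_posPart_sub_negPart (hA : IsSelfAdjoint A) (f : E) :
    (⟪f, A f⟫_ℂ).re = (⟪f, A⁺ f⟫_ℂ).re - (⟪f, A⁻ f⟫_ℂ).re := by
  conv_lhs => rw [← CFC.posPart_sub_negPart A hA]
  simp

lemma eq_zero_of_mem_range_negPart {f : E} (hf : f ∈ ((A⁻ : E →L[ℂ] E) : E →ₗ[ℂ] E).range)
    (h : A⁻ f = 0) : f = 0 := by
  obtain ⟨y, rfl⟩ := hf
  have hsymm := ((ContinuousLinearMap.nonneg_iff_isPositive _).1 (CFC.negPart_nonneg A)).isSymmetric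
  rw [ContinuousLinearMap.coe_coe] at h ⊢
  rw [← inner_self_eq_zero (𝕜 := ℂ), hsymm.apply_clm, h, inner_zero_right]

lemma re_inner_eq_neg_negPart (hA : IsSelfAdjoint A) {f : E}
    (hf : f ∈ ((A⁻ : E →L[ℂ] E) : E →ₗ[ℂ] E).range) :
    (⟪f, A f⟫_ℂ).re = -(⟪f, A⁻ f⟫_ℂ).re := by
  obtain ⟨y, rfl⟩ := hf
  have hpos : A⁺ (A⁻ y) = 0 := DFunLike.congr_fun (CFC.posPart_mul_negPart A) y
  simp [re_inner_eq_posPart_sub_negPart hA, hpos]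

lemma exists_re_inner_le_on_range_negPart (hA : IsSelfAdjoint A)
    [FiniteDimensional ℂ ((A⁻ : E →L[ℂ] E) : E →ₗ[ℂ] E).range] :
    ∃ c > 0, ∀ f ∈ ((A⁻ : E →L[ℂ] E) : E →ₗ[ℂ] E).range, (⟪f, A f⟫_ℂ).re ≤ -(c * ‖f‖ ^ 2) := by
  obtain ⟨c, hc, h⟩ := exists_mul_norm_sq_le_re_inner (CFC.negPart_nonneg A) _
    fun _ hf => eq_zero_of_mem_range_negPart hf
  exact ⟨c, hc, fun f hf => (re_inner_eq_neg_negPart hA hf).le.trans (neg_le_neg (h f hf))⟩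

lemma re_inner_neg_of_mem_range_negPart (hA : IsSelfAdjoint A) {f : E}
    (hf : f ∈ ((A⁻ : E →L[ℂ] E) : E →ₗ[ℂ] E).range) (h0 : f ≠ 0) : (⟪f, A f⟫_ℂ).re < 0 := by
  obtain ⟨S, hS, hSf⟩ := exists_re_inner_eq_norm_sq (CFC.negPart_nonneg A)
  rw [re_inner_eq_neg_negPart hA hf, hSf, neg_lt_zero]
  have hne : S f ≠ 0 := fun h => h0 <| eq_zero_of_mem_range_negPart hf <| by
    rw [hS, mul_apply_eq_comp, h, map_zero]
  positivity

lemma finiteDimensional_range_negPart (hA : IsSelfAdjoint A)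
    [FiniteDimensional ℂ (A : E →ₗ[ℂ] E).range] :
    FiniteDimensional ℂ ((A⁻ : E →L[ℂ] E) : E →ₗ[ℂ] E).range := by
  refine FiniteDimensional.of_injective
    ((A : E →ₗ[ℂ] E).rangeRestrict ∘ₗ ((A⁻ : E →L[ℂ] E) : E →ₗ[ℂ] E).range.subtype)
    ((injective_iff_map_eq_zero _).2 fun f hf => ?_)
  have hAf : A f = 0 := congrArg Subtype.val hf
  by_contra h0
  have hneg := re_inner_neg_of_mem_range_negPart hA f.2 (by simpa using h0)
  simp [hAf] at hneg

lemma nminus_le_finrank (hA : IsSelfAdjoint A) {M : Type*} [AddCommGroup M] [Module ℂ M]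
    [FiniteDimensional ℂ M] (J : E →ₗ[ℂ] M) (h : ∀ f, J f = 0 → 0 ≤ (⟪f, A f⟫_ℂ).re) :
    Nminus A ≤ Module.finrank ℂ M := by
  have hinj : Function.Injective
      (J ∘ₗ ((A⁻ : E →L[ℂ] E) : E →ₗ[ℂ] E).range.subtype) := by
    refine (injective_iff_map_eq_zero _).2 fun f hf => ?_
    by_contra h0
    exact (h f hf).not_gt (re_inner_neg_of_mem_range_negPart hA f.2 (by simpa using h0))
  have := FiniteDimensional.of_injective _ hinj
  rw [Nminus, ← Module.finrank_eq_rank, Cardinal.toENat_nat]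
  exact_mod_cast LinearMap.finrank_le_finrank_of_injective hinj

lemma rank_le_nminus {W : Type*} [AddCommGroup W] [Module ℂ W] (hA : IsSelfAdjoint A)
    (R : W →ₗ[ℂ] E) (h : ∀ w ≠ 0, (⟪R w, A (R w)⟫_ℂ).re < 0) :
    Cardinal.toENat (Module.rank ℂ W) ≤ Nminus A := by
  have hinj : Function.Injective
      (((A⁻ : E →L[ℂ] E) : E →ₗ[ℂ] E).rangeRestrict ∘ₗ R) := by
    refine (injective_iff_map_eq_zero _).2 fun w hw => ?_
    by_contra h0
    have hnegPart : A⁻ (R w) = 0 := congrArg Subtype.val hw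
    have hpos : 0 ≤ (⟪R w, A⁺ (R w)⟫_ℂ).re :=
      ((ContinuousLinearMap.nonneg_iff_isPositive _).1
        (CFC.posPart_nonneg A)).re_inner_nonneg_right _
    have := h w h0
    rw [re_inner_eq_posPart_sub_negPart hA, hnegPart, inner_zero_right, Complex.zero_re] at this
    linarith
  have hrank := LinearMap.lift_rank_le_of_injective _ hinj
  simpa [Nminus] using Cardinal.toENat.monotone' hrank

lemma rank_range_le_nminus_add_nminus_neg (hA : IsSelfAdjoint A) :
    Cardinal.toENat (Module.rank ℂ (A : E →ₗ[ℂ] E).range) ≤ Nminus A + Nminus (-A) := by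
  have hle : (A : E →ₗ[ℂ] E).range ≤ ((A⁻ : E →L[ℂ] E) : E →ₗ[ℂ] E).range ⊔
      (((-A)⁻ : E →L[ℂ] E) : E →ₗ[ℂ] E).range := by
    rintro _ ⟨y, rfl⟩
    have hAy : A y = A⁺ y - A⁻ y := by
      conv_lhs => rw [← CFC.posPart_sub_negPart A hA]
      rfl
    rw [CFC.negPart_neg, ContinuousLinearMap.coe_coe, hAy]
    exact Submodule.sub_mem _ (Submodule.mem_sup_right ⟨y, rfl⟩) (Submodule.mem_sup_left ⟨y, rfl⟩)
  have hrank := (Submodule.rank_mono hle).trans (Submodule.rank_add_le_rank_add_rank _ _)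
  exact (Cardinal.toENat.monotone' hrank).trans (map_add Cardinal.toENat _ _).le

lemma isPositive_iff_nminus_eq_zero (hA : IsSelfAdjoint A) : A.IsPositive ↔ Nminus A = 0 := by
  rw [← ContinuousLinearMap.nonneg_iff_isPositive, ← CFC.negPart_eq_zero_iff A hA, Nminus,
    Cardinal.toENat_eq_zero, Submodule.rank_eq_zero, LinearMap.range_eq_bot,
    ← ContinuousLinearMap.toLinearMap_zero, ContinuousLinearMap.coe_inj]

lemma map_mem_closure_map_orthogonal (T : E →L[ℂ] G) {F : Submodule ℂ E} [FiniteDimensional ℂ F]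
    (hTF : Disjoint F (adjoint T : G →ₗ[ℂ] E).range) (e : E) :
    T e ∈ (Fᗮ.map (T : E →ₗ[ℂ] G)).topologicalClosure := by
  rw [← Submodule.orthogonal_orthogonal_eq_closure, Submodule.mem_orthogonal]
  intro g hg
  have hgF : adjoint T g ∈ F := by
    rw [← F.orthogonal_orthogonal, Submodule.mem_orthogonal]
    intro y hy
    rw [ContinuousLinearMap.adjoint_inner_right]
    exact hg _ (Submodule.mem_map_of_mem hy)
  rw [← ContinuousLinearMap.adjoint_inner_left,
    Submodule.disjoint_def.1 hTF _ hgF ⟨g, rfl⟩, inner_zero_left]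

/-- Modifying `w` in the range of `V⁻` by a vector of `ker V` does not change the form of `V`, and
can make `T w`, hence the form of `A`, arbitrarily small. -/
theorem nminus_le_nminus_add (hA : IsSelfAdjoint A) (hV : IsSelfAdjoint V) (T : E →L[ℂ] G) {C : ℝ}
    (hAT : ∀ f, (⟪f, A f⟫_ℂ).re ≤ C * ‖T f‖ ^ 2) [FiniteDimensional ℂ (V : E →ₗ[ℂ] E).range]
    (hVT : Disjoint (V : E →ₗ[ℂ] E).range (adjoint T : G →ₗ[ℂ] E).range) :
    Nminus V ≤ Nminus (A + V) := by
  have := finiteDimensional_range_negPart hV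
  obtain ⟨c, hc, hcV⟩ := exists_re_inner_le_on_range_negPart hV
  obtain ⟨δ, hδ, hδc⟩ : ∃ δ > 0, |C| * δ < c := exists_pos_mul_lt hc _
  obtain ⟨κ, hκ⟩ := exists_linearMap_norm_sub_le (W := ((V⁻ : E →L[ℂ] E) : E →ₗ[ℂ] E).range) T
    (map_mem_closure_map_orthogonal T hVT) (Real.sqrt_pos.2 hδ)
  refine rank_le_nminus (hA.add hV)
    (Submodule.subtype _ - (V : E →ₗ[ℂ] E).rangeᗮ.subtype ∘ₗ κ) fun w hw => ?_
  simp only [LinearMap.sub_apply, Submodule.subtype_apply, LinearMap.comp_apply]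
  have hVκ : V (κ w) = 0 := by
    have hker := V.orthogonal_range
    rw [hV.adjoint_eq] at hker
    exact hker.le (κ w).2
  have hVform : ⟪(w : E) - κ w, V (w - κ w)⟫_ℂ = ⟪(w : E), V w⟫_ℂ := by
    rw [← hV.isSymmetric.apply_clm, map_sub, hVκ, sub_zero, inner_sub_right,
      hV.isSymmetric.apply_clm, hV.isSymmetric.apply_clm, hVκ, inner_zero_right, sub_zero]
  have hAform : (⟪(w : E) - κ w, A (w - κ w)⟫_ℂ).re ≤ |C| * δ * ‖(w : E)‖ ^ 2 := by
    calc _ ≤ |C| * ‖T (w - κ w)‖ ^ 2 := (hAT _).trans (by gcongr; exact le_abs_self C)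
      _ ≤ |C| * (√δ * ‖w‖) ^ 2 := by gcongr; exact hκ w
      _ = _ := by rw [mul_pow, Real.sq_sqrt hδ.le, Submodule.coe_norm]; ring
  have hw' : 0 < ‖(w : E)‖ := norm_pos_iff.2 (by simpa using hw)
  have hlt : |C| * δ * ‖(w : E)‖ ^ 2 < c * ‖(w : E)‖ ^ 2 := by gcongr
  rw [add_apply, inner_add_right, Complex.add_re, hVform]
  linarith [hcV w w.2]

end NegativeIndex

/-! ### Exponential polynomials -/

section ExponentialPolynomials

/-- The exponential polynomial `P(t) e^{-βt}` of a real variable. -/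
noncomputable def expPoly (β : ℂ) (P : ℂ[X]) (t : ℝ) : ℂ := P.eval (t : ℂ) * Complex.exp (-(β * t))

lemma continuous_expPoly (β : ℂ) (P : ℂ[X]) : Continuous (expPoly β P) := by
  have := P.continuous
  unfold expPoly
  fun_prop

lemma expPoly_mul_exp (β γ : ℂ) (P : ℂ[X]) (t : ℝ) :
    expPoly β P t * Complex.exp (γ * t) = expPoly (β - γ) P t := by
  rw [expPoly, expPoly, mul_assoc, ← Complex.exp_add]
  ring_nf

lemma hasDerivAt_expPoly (β : ℂ) (P : ℂ[X]) (t : ℝ) :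
    HasDerivAt (expPoly β P) (expPoly β (P.derivative - Polynomial.C β * P) t) t := by
  have h : HasDerivAt (fun z : ℂ => P.eval z * Complex.exp (-(β * z)))
      (P.derivative.eval (t : ℂ) * Complex.exp (-(β * t)) +
        P.eval (t : ℂ) * (Complex.exp (-(β * t)) * (-(β * 1)))) (t : ℂ) :=
    (P.hasDerivAt _).mul (((hasDerivAt_id _).const_mul β).neg.cexp)
  refine h.comp_ofReal.congr_deriv ?_
  simp only [expPoly, Polynomial.eval_sub, Polynomial.eval_mul, Polynomial.eval_C]
  ring

lemma eq_zero_of_derivative_sub_C_mul_eq_zero {R : Type*} [CommRing R] [NoZeroDivisors R] {β : R}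
    (hβ : β ≠ 0) {P : R[X]} (h : P.derivative - Polynomial.C β * P = 0) : P = 0 := by
  by_contra hP
  have hcoeff := congrArg (Polynomial.coeff · P.natDegree) h
  simp only [Polynomial.coeff_sub, Polynomial.coeff_derivative, Polynomial.coeff_C_mul,
    Polynomial.coeff_natDegree, Polynomial.coeff_zero,
    Polynomial.coeff_eq_zero_of_natDegree_lt (Nat.lt_succ_self _)] at hcoeff
  simp [hβ, hP] at hcoeff

variable {ι : Type*} {U : Set ℝ}

/-- Differentiating `deg Q + 1` times removes `Q` and does not annihilate any `P i ≠ 0`. -/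
lemma expPoly_eq_zero_of_sum_add_eval_eq_zero (hU : IsOpen U) {s : Finset ι} {β : ι → ℂ}
    (hβ : ∀ i ∈ s, β i ≠ 0)
    (hs : ∀ P : ι → ℂ[X], (∀ t ∈ U, ∑ i ∈ s, expPoly (β i) (P i) t = 0) → ∀ i ∈ s, P i = 0)
    {n : ℕ} : ∀ (P : ι → ℂ[X]) (Q : ℂ[X]), Q.degree < n →
      (∀ t ∈ U, ∑ i ∈ s, expPoly (β i) (P i) t + Q.eval (t : ℂ) = 0) → ∀ i ∈ s, P i = 0 := by
  induction n with
  | zero =>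
    intro P Q hQ h
    have hQ0 : Q = 0 := by simpa using hQ
    exact hs P fun t ht => by simpa [hQ0] using h t ht
  | succ n ih =>
    intro P Q hQ h i hi
    have hdegree : Q.derivative.degree < n := by
      by_cases hQ0 : Q = 0
      · simp [hQ0, bot_lt_iff_ne_bot]
      · exact (Polynomial.degree_derivative_lt hQ0).trans_le (Order.le_of_lt_succ hQ)
    have hderiv : ∀ t ∈ U, ∑ i ∈ s, expPoly (β i)
        ((P i).derivative - Polynomial.C (β i) * P i) t + Q.derivative.eval (t : ℂ) = 0 := by
      intro t ht
      refine ((HasDerivAt.fun_sum fun i _ => hasDerivAt_expPoly (β i) (P i) t).add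
        (Q.hasDerivAt _).comp_ofReal).unique
          ((hasDerivAt_const t (0 : ℂ)).congr_of_eventuallyEq ?_)
      filter_upwards [hU.mem_nhds ht] with u hu using h u hu
    exact eq_zero_of_derivative_sub_C_mul_eq_zero (hβ i hi) (ih _ _ hdegree hderiv i hi)

lemma eq_zero_of_expPoly_eq_zero (hU : IsOpen U) (hne : U.Nonempty) {β : ℂ} {P : ℂ[X]}
    (h : ∀ t ∈ U, expPoly β P t = 0) : P = 0 := by
  obtain ⟨x, hx⟩ := hne
  refine Polynomial.eq_zero_of_infinite_isRoot _ <|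
    ((infinite_of_mem_nhds x (hU.mem_nhds hx)).image Complex.ofReal_injective.injOn).mono ?_
  rintro _ ⟨t, ht, rfl⟩
  simpa [expPoly] using h t ht

theorem eq_zero_of_sum_expPoly_eq_zero (hU : IsOpen U) (hne : U.Nonempty) (s : Finset ι) :
    ∀ {β : ι → ℂ} {P : ι → ℂ[X]}, Set.InjOn β s →
      (∀ t ∈ U, ∑ i ∈ s, expPoly (β i) (P i) t = 0) → ∀ i ∈ s, P i = 0 := by
  classical
  induction s using Finset.induction_on with
  | empty => simp
  | insert j s hj ih =>
    intro β P hβ h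
    have hβs : Set.InjOn (fun i => β i - β j) s := fun x hx y hy hxy =>
      hβ (Finset.mem_insert_of_mem hx) (Finset.mem_insert_of_mem hy) (sub_left_injective hxy)
    have hβ0 : ∀ i ∈ s, β i - β j ≠ 0 := fun i hi h0 => hj <|
      hβ (Finset.mem_insert_of_mem hi) (Finset.mem_insert_self j s) (sub_eq_zero.1 h0) ▸ hi
    have hP : ∀ i ∈ s, P i = 0 := by
      refine expPoly_eq_zero_of_sum_add_eval_eq_zero hU hβ0 (fun P => ih hβs) P (P j)
        (Polynomial.degree_le_natDegree.trans_lt (by exact_mod_cast Nat.lt_succ_self _))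
        fun t ht => ?_
      have hmul := congrArg (· * Complex.exp (β j * t)) (h t ht)
      simp only [Finset.sum_insert hj, add_mul, Finset.sum_mul, expPoly_mul_exp, zero_mul] at hmul
      simpa [expPoly, add_comm] using hmul
    refine Finset.forall_mem_insert _ _ _ |>.2 ⟨?_, hP⟩
    refine eq_zero_of_expPoly_eq_zero hU hne (β := β j) fun t ht => ?_
    have hsum := h t ht
    rwa [Finset.sum_insert hj, Finset.sum_eq_zero fun i hi => by simp [hP i hi, expPoly],
      add_zero] at hsum

end ExponentialPolynomials

section ExponentialMonomials

lemma memLp_pow_mul_exp {β : ℂ} (hβ : 0 < β.re) (j : ℕ) :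
    MemLp (fun t : ℝ => (t : ℂ) ^ j * Complex.exp (-(β * t))) 2
      (volume.restrict (Set.Ioi (0 : ℝ))) := by
  have hc : Continuous fun t : ℝ => (t : ℂ) ^ j * Complex.exp (-(β * t)) := by fun_prop
  rw [memLp_two_iff_integrable_sq_norm hc.aestronglyMeasurable]
  have hint := integrableOn_rpow_mul_exp_neg_mul_rpow (s := ((2 * j : ℕ) : ℝ)) (p := 1)
    (b := 2 * β.re) (by linarith [Nat.cast_nonneg (α := ℝ) (2 * j)]) one_pos (by linarith)
  refine hint.congr_fun (fun t (ht : 0 < t) => ?_) measurableSet_Ioi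
  simp only [norm_mul, norm_pow, Complex.norm_exp, mul_pow, Complex.norm_real, Real.norm_eq_abs,
    abs_of_pos ht, Real.rpow_natCast, Real.rpow_one, ← Real.exp_nat_mul, ← pow_mul, mul_comm j]
  simp [mul_assoc]

/-- The function `t ^ j e^{-βt}` as an element of `L²(ℝ₊)`. It is set to zero if `Re β ≤ 0`, where
the function is not square integrable. -/
noncomputable def expVec (β : ℂ) (j : ℕ) : L2Plus :=
  if h : 0 < β.re then (memLp_pow_mul_exp h j).toLp _ else 0

lemma coeFn_expVec {β : ℂ} (hβ : 0 < β.re) (j : ℕ) :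
    expVec β j =ᵐ[volume.restrict (Set.Ioi (0 : ℝ))]
      fun t : ℝ => (t : ℂ) ^ j * Complex.exp (-(β * t)) := by
  rw [expVec, dif_pos hβ]
  exact MemLp.coeFn_toLp _

lemma inner_expVec_conj {β : ℂ} (hβ : 0 < β.re) (j : ℕ) (f : L2Plus) :
    ⟪expVec (conj β) j, f⟫_ℂ =
      ∫ s in Set.Ioi (0 : ℝ), (s : ℂ) ^ j * Complex.exp (-(β * s)) * f s := by
  rw [L2.inner_def]
  refine integral_congr_ae ?_
  filter_upwards [coeFn_expVec (β := conj β) (by simpa using hβ) j] with s hs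
  simp [hs, ← Complex.exp_conj, mul_comm]

lemma integrable_pow_mul_exp_mul {β : ℂ} (hβ : 0 < β.re) (j : ℕ) (f : L2Plus) :
    Integrable (fun s : ℝ => (s : ℂ) ^ j * Complex.exp (-(β * s)) * f s)
      (volume.restrict (Set.Ioi (0 : ℝ))) :=
  (memLp_pow_mul_exp hβ j).integrable_mul (Lp.memLp f)

lemma coeFn_sum_smul_expVec {τ : Type*} (s : Finset τ) {β : τ → ℂ} (hβ : ∀ p ∈ s, 0 < (β p).re)
    (j : τ → ℕ) (c : τ → ℂ) :
    (∑ p ∈ s, c p • expVec (β p) (j p) : L2Plus) =ᵐ[volume.restrict (Set.Ioi (0 : ℝ))]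
      fun t => ∑ p ∈ s, c p * ((t : ℂ) ^ j p * Complex.exp (-(β p * t))) := by
  have hterm : ∀ᵐ t ∂(volume.restrict (Set.Ioi (0 : ℝ))), ∀ p ∈ s,
      (c p • expVec (β p) (j p) : L2Plus) t =
        c p * ((t : ℂ) ^ j p * Complex.exp (-(β p * t))) := by
    refine (Filter.eventually_all_finset s).2 fun p hp => ?_
    filter_upwards [Lp.coeFn_smul (c p) (expVec (β p) (j p)), coeFn_expVec (hβ p hp) (j p)]
      with t hsmul hexp
    rw [hsmul, Pi.smul_apply, hexp, smul_eq_mul]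
  filter_upwards [Lp.coeFn_fun_finsetSum s fun p => c p • expVec (β p) (j p), hterm]
    with t hsum hterm
  rw [hsum, Finset.sum_congr rfl hterm]

lemma linearIndependent_expVec {ι : Type*} [Finite ι] {β : ι → ℂ} (hβ : ∀ i, 0 < (β i).re)
    (hinj : Function.Injective β) (K : ι → ℕ) :
    LinearIndependent ℂ fun p : Σ i, Fin (K i) => expVec (β p.1) p.2 := by
  have := Fintype.ofFinite ι
  rw [Fintype.linearIndependent_iff]
  intro d hd
  let P (i : ι) : ℂ[X] := ∑ a : Fin (K i), Polynomial.monomial a (d ⟨i, a⟩)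
  have hae : (fun t : ℝ => ∑ i, expPoly (β i) (P i) t) =ᵐ[volume.restrict (Set.Ioi (0 : ℝ))]
      fun _ => 0 := by
    have hzero := Lp.coeFn_zero ℂ 2 (volume.restrict (Set.Ioi (0 : ℝ)))
    rw [← hd] at hzero
    filter_upwards [hzero, coeFn_sum_smul_expVec Finset.univ (fun p _ => hβ p.1)
      (fun p : Σ i, Fin (K i) => (p.2 : ℕ)) d] with t ht hsum
    rw [ht, Pi.zero_apply, Fintype.sum_sigma] at hsum
    simp [hsum, P, expPoly, Polynomial.eval_finsetSum, Finset.sum_mul, mul_assoc]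
  have hzero : ∀ t ∈ Set.Ioi (0 : ℝ), ∑ i, expPoly (β i) (P i) t = 0 := fun t ht =>
    Measure.eqOn_open_of_ae_eq hae isOpen_Ioi
      (continuous_finsetSum _ fun i _ => continuous_expPoly (β i) (P i)).continuousOn
      continuousOn_const ht
  rintro ⟨i, a⟩
  have hPi := eq_zero_of_sum_expPoly_eq_zero isOpen_Ioi Set.nonempty_Ioi Finset.univ hinj.injOn
    hzero i (Finset.mem_univ i)
  have hcoeff := congrArg (Polynomial.coeff · a) hPi
  simpa [P, Polynomial.finsetSum_coeff, Polynomial.coeff_monomial, Fin.val_inj] using hcoeff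

end ExponentialMonomials

/-! ### The form of a finite rank Hankel operator -/

section HankelForm

/-- The coefficient of `sᵃ tᵇ` in `P(s + t)`. Up to the factors `a!` and `b!` these numbers form
the Hankel matrix of the coefficients of `P`; they vanish for `a + b > deg P`, so that the matrix
is triangular with respect to its antidiagonal. -/
def addCoeff {R : Type*} [Semiring R] (P : R[X]) (a b : ℕ) : R :=
  P.coeff (a + b) * ((a + b).choose a : R)

/-- The matrix `addCoeff P a b`, `0 ≤ a, b ≤ deg P`, applied to the vector `x`. -/
def addMulVec {R : Type*} [Semiring R] (P : R[X]) (x : ℕ → R) (b : ℕ) : R :=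
  ∑ a ∈ Finset.range (P.natDegree + 1), addCoeff P a b * x a

/-- The bilinear form of the matrix `addCoeff P a b`, `0 ≤ a, b ≤ deg P`. -/
def hankelForm {R : Type*} [Semiring R] (P : R[X]) (x y : ℕ → R) : R :=
  ∑ b ∈ Finset.range (P.natDegree + 1), addMulVec P x b * y b

variable {R : Type*} [CommRing R] {P : R[X]} {x y : ℕ → R}

lemma addCoeff_eq_zero {a b : ℕ} (h : P.natDegree < a + b) : addCoeff P a b = 0 := by
  rw [addCoeff, Polynomial.coeff_eq_zero_of_natDegree_lt h, zero_mul]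

lemma addCoeff_comm (P : R[X]) (a b : ℕ) : addCoeff P a b = addCoeff P b a := by
  rw [addCoeff, addCoeff, add_comm b a, ← Nat.choose_symm_add]

lemma hankelForm_comm (P : R[X]) (x y : ℕ → R) : hankelForm P x y = hankelForm P y x := by
  simp only [hankelForm, addMulVec, Finset.sum_mul]
  rw [Finset.sum_comm]
  simp only [addCoeff_comm P, mul_right_comm]

lemma map_hankelForm {S : Type*} [CommRing S] {φ : R →+* S} (hφ : Function.Injective φ)
    (P : R[X]) (x y : ℕ → R) :
    φ (hankelForm P x y) = hankelForm (P.map φ) (φ ∘ x) (φ ∘ y) := by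
  simp [hankelForm, addMulVec, addCoeff, Polynomial.natDegree_map_eq_of_injective hφ]

lemma eval_add_eq_hankelForm (P : R[X]) (s t : R) :
    P.eval (s + t) = hankelForm P (s ^ ·) (t ^ ·) := by
  rw [hankelForm_comm, add_comm, add_comm t, ← Polynomial.taylor_eval,
    Polynomial.eval_eq_sum_range, Polynomial.natDegree_taylor]
  refine Finset.sum_congr rfl fun a _ => ?_
  rw [Polynomial.taylor_coeff, Polynomial.eval_eq_sum_range' (n := P.natDegree + 1)
    ((Polynomial.natDegree_hasseDeriv_le P a).trans_lt (by lia))]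
  simp only [Polynomial.hasseDeriv_coeff, addMulVec, addCoeff, mul_comm, Nat.choose_symm_add]

lemma hankelForm_eq_zero {r r' : ℕ} (h : P.natDegree < r + r') (hx : ∀ a < r, x a = 0)
    (hy : ∀ b < r', y b = 0) : hankelForm P x y = 0 := by
  refine Finset.sum_eq_zero fun b _ => ?_
  rcases lt_or_ge b r' with hb | hb
  · rw [hy b hb, mul_zero]
  rw [addMulVec, Finset.sum_eq_zero fun a _ => ?_, zero_mul]
  rcases lt_or_ge a r with ha | ha
  · rw [hx a ha, mul_zero]
  · rw [addCoeff_eq_zero (by lia), zero_mul]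

lemma addMulVec_eq_mul {a b : ℕ} (h : a + b = P.natDegree) (hx : ∀ c < a, x c = 0) :
    addMulVec P x b = addCoeff P a b * x a := by
  refine Finset.sum_eq_single_of_mem a (Finset.mem_range.2 (by lia)) fun c _ hc => ?_
  rcases lt_or_gt_of_ne hc with hlt | hgt
  · rw [hx c hlt, mul_zero]
  · rw [addCoeff_eq_zero (by lia), zero_mul]

lemma hankelForm_eq_mul {r : ℕ} (h : P.natDegree = 2 * r) (hx : ∀ a < r, x a = 0)
    (hy : ∀ b < r, y b = 0) : hankelForm P x y = addCoeff P r r * x r * y r := by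
  rw [hankelForm, Finset.sum_eq_single_of_mem r (Finset.mem_range.2 (by lia)),
    addMulVec_eq_mul (by lia) hx]
  intro b _ hb
  rcases lt_or_gt_of_ne hb with hlt | hgt
  · rw [hy b hlt, mul_zero]
  · rw [addMulVec, Finset.sum_eq_zero fun a _ => ?_, zero_mul]
    rcases lt_or_ge a r with ha | ha
    · rw [hx a ha, mul_zero]
    · rw [addCoeff_eq_zero (by lia), zero_mul]

lemma eq_zero_of_addMulVec_eq_zero [NoZeroDivisors R] [CharZero R] (hP : P ≠ 0)
    (h : ∀ b ≤ P.natDegree, addMulVec P x b = 0) : ∀ a ≤ P.natDegree, x a = 0 := by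
  intro a
  induction a using Nat.strong_induction_on with
  | _ a ih =>
    intro ha
    have hmul := h (P.natDegree - a) (Nat.sub_le _ _)
    rw [addMulVec_eq_mul (Nat.add_sub_cancel' ha) fun c hc => ih c hc (by lia)] at hmul
    refine (mul_eq_zero.1 hmul).resolve_left ?_
    rw [addCoeff, Nat.add_sub_cancel' ha]
    exact mul_ne_zero (by simpa using hP) (by exact_mod_cast (Nat.choose_pos ha).ne')

end HankelForm

section NegNumber

variable {P : ℝ[X]}

lemma negNumber_add_negNumber_neg (hP : P ≠ 0) :
    negNumber P + negNumber (-P) = P.natDegree + 1 := by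
  have hfact : (0 : ℝ) < P.natDegree.factorial := by positivity
  have hlead : P.leadingCoeff ≠ 0 := by simpa using hP
  simp only [negNumber, Polynomial.natDegree_neg, Polynomial.leadingCoeff_neg,
    mul_pos_iff_of_pos_left hfact, neg_pos]
  rcases hlead.lt_or_gt with hneg | hpos
  · simp only [hneg, hneg.not_gt]
    grind
  · simp only [hpos, hpos.not_gt]
    grind

/-- If `x` vanishes below `𝒩₋`, then the form vanishes by triangularity unless `deg P` is even and
the leading coefficient is positive; then only the middle entry of the antidiagonal survives. -/
lemma re_hankelForm_nonneg {x : ℕ → ℂ} (hx : ∀ a < negNumber P, x a = 0) :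
    0 ≤ (hankelForm (P.map Complex.ofRealHom) x fun b => conj (x b)).re := by
  have hdeg : (P.map Complex.ofRealHom).natDegree = P.natDegree := Polynomial.natDegree_map _
  have hconj : ∀ b < negNumber P, conj (x b) = 0 := fun b hb => by rw [hx b hb, map_zero]
  rcases lt_or_ge P.natDegree (negNumber P + negNumber P) with h | h
  · rw [hankelForm_eq_zero (hdeg ▸ h) hx hconj, Complex.zero_re]
  obtain ⟨hmiddle, hlead⟩ : P.natDegree = 2 * negNumber P ∧ 0 < P.leadingCoeff := by
    have hfact : (0 : ℝ) < P.natDegree.factorial := by positivity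
    simp only [negNumber, mul_pos_iff_of_pos_left hfact] at h ⊢
    grind
  have hform : hankelForm (P.map Complex.ofRealHom) x (fun b => conj (x b)) =
      ((P.leadingCoeff * (2 * negNumber P).choose (negNumber P) * ‖x (negNumber P)‖ ^ 2 : ℝ) :
        ℂ) := by
    rw [hankelForm_eq_mul (hdeg.trans hmiddle) hx hconj, mul_assoc, Complex.mul_conj, addCoeff,
      Polynomial.coeff_map, ← two_mul, Polynomial.leadingCoeff, hmiddle,
      Complex.normSq_eq_norm_sq]
    simp
  rw [hform, Complex.ofReal_re]
  positivity

end NegNumber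

section FiniteRank

lemma expPoly_add (β : ℂ) (P : ℂ[X]) (t s : ℝ) :
    expPoly β P (t + s) = hankelForm P (fun a => (s : ℂ) ^ a * Complex.exp (-(β * s)))
      fun b => (t : ℂ) ^ b * Complex.exp (-(β * t)) := by
  have hexp : Complex.exp (-(β * (t + s : ℝ))) =
      Complex.exp (-(β * s)) * Complex.exp (-(β * t)) := by
    rw [← Complex.exp_add]
    push_cast
    ring_nf
  rw [expPoly, hexp, Complex.ofReal_add, add_comm (t : ℂ), eval_add_eq_hankelForm]
  simp only [hankelForm, addMulVec, Finset.sum_mul]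
  refine Finset.sum_congr rfl fun b _ => Finset.sum_congr rfl fun a _ => ?_
  ring

lemma integrable_expPoly_add_mul {β : ℂ} (hβ : 0 < β.re) (P : ℂ[X]) (t : ℝ) (f : L2Plus) :
    Integrable (fun s => expPoly β P (t + s) * f s) (volume.restrict (Set.Ioi (0 : ℝ))) := by
  simp only [expPoly_add, hankelForm, addMulVec, Finset.sum_mul]
  refine integrable_finsetSum _ fun b _ => integrable_finsetSum _ fun a _ => ?_
  exact ((integrable_pow_mul_exp_mul hβ a f).const_mul
    (addCoeff P a b * ((t : ℂ) ^ b * Complex.exp (-(β * t))))).congr (.of_forall fun s => by ring)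

lemma integral_expPoly_add_mul {β : ℂ} (hβ : 0 < β.re) (P : ℂ[X]) (t : ℝ) (f : L2Plus) :
    ∫ s in Set.Ioi (0 : ℝ), expPoly β P (t + s) * f s =
      hankelForm P (fun a => ⟪expVec (conj β) a, f⟫_ℂ)
        fun b => (t : ℂ) ^ b * Complex.exp (-(β * t)) := by
  have hint (a b : ℕ) := (integrable_pow_mul_exp_mul hβ a f).const_mul
    (addCoeff P a b * ((t : ℂ) ^ b * Complex.exp (-(β * t))))
  have hexpand (s : ℝ) : expPoly β P (t + s) * f s =
      ∑ b ∈ Finset.range (P.natDegree + 1), ∑ a ∈ Finset.range (P.natDegree + 1),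
        addCoeff P a b * ((t : ℂ) ^ b * Complex.exp (-(β * t))) *
          ((s : ℂ) ^ a * Complex.exp (-(β * s)) * f s) := by
    simp only [expPoly_add, hankelForm, addMulVec, Finset.sum_mul]
    refine Finset.sum_congr rfl fun b _ => Finset.sum_congr rfl fun a _ => ?_
    ring
  simp only [hexpand]
  rw [integral_finsetSum _ fun b _ => integrable_finsetSum _ fun a _ => hint a b]
  refine Finset.sum_congr rfl fun b _ => ?_
  rw [integral_finsetSum _ fun a _ => hint a b, addMulVec, Finset.sum_mul]
  refine Finset.sum_congr rfl fun a _ => ?_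
  rw [integral_const_mul, inner_expVec_conj hβ]
  ring

variable {ι : Type*} [Fintype ι] {β : ι → ℂ} {P : ι → ℂ[X]} {V : L2Plus →L[ℂ] L2Plus}

lemma hankel_apply (hβ : ∀ i, 0 < (β i).re)
    (hV : IsHankelIntegralOperator V fun t => ∑ i, expPoly (β i) (P i) t) (f : L2Plus) :
    V f = ∑ p : Σ i, Fin ((P i).natDegree + 1),
      addMulVec (P p.1) (fun a => ⟪expVec (conj (β p.1)) a, f⟫_ℂ) p.2 • expVec (β p.1) p.2 := by
  refine Lp.ext ?_
  filter_upwards [hV f, coeFn_sum_smul_expVec Finset.univ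
    (fun (p : Σ i, Fin ((P i).natDegree + 1)) _ => hβ p.1) (fun p => (p.2 : ℕ))
    fun p => addMulVec (P p.1) (fun a => ⟪expVec (conj (β p.1)) a, f⟫_ℂ) p.2] with t hVt hsum
  rw [hVt, hsum, Fintype.sum_sigma]
  simp only [Finset.sum_mul]
  rw [integral_finsetSum _ fun i _ => integrable_expPoly_add_mul (hβ i) (P i) t f]
  refine Finset.sum_congr rfl fun i _ => ?_
  rw [integral_expPoly_add_mul (hβ i), hankelForm, Finset.sum_range]

lemma inner_hankel_apply (hβ : ∀ i, 0 < (β i).re)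
    (hV : IsHankelIntegralOperator V fun t => ∑ i, expPoly (β i) (P i) t) (f g : L2Plus) :
    ⟪g, V f⟫_ℂ = ∑ i, hankelForm (P i) (fun a => ⟪expVec (conj (β i)) a, f⟫_ℂ)
      fun b => ⟪g, expVec (β i) b⟫_ℂ := by
  rw [hankel_apply hβ hV, inner_sum, Fintype.sum_sigma]
  simp only [inner_smul_right, hankelForm, Finset.sum_range]

lemma IsHankelIntegralOperator.neg {v : ℝ → ℂ} (hV : IsHankelIntegralOperator V v) :
    IsHankelIntegralOperator (-V) (-v) := by
  intro f
  filter_upwards [hV f, Lp.coeFn_neg (V f)] with t ht hneg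
  rw [neg_apply, hneg, Pi.neg_apply, ht]
  simp [integral_neg]

end FiniteRank

namespace FiniteRankKernel

variable (k : FiniteRankKernel)

/-- The index set of all exponents of the kernel: the real ones, those in the upper half-plane and
the complex conjugates of the latter. -/
abbrev Index : Type := Fin k.M₀ ⊕ (Fin k.M₁ ⊕ Fin k.M₁)

/-- The family of all exponents of the kernel, complex conjugate ones included. -/
noncomputable def exponent : k.Index → ℂ :=
  Sum.elim (fun m => (k.α m : ℂ)) (Sum.elim k.γ fun m => conj (k.γ m))

/-- The polynomial factors that belong to the exponents `FiniteRankKernel.exponent`. -/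
noncomputable def poly : k.Index → ℂ[X] :=
  Sum.elim (fun m => (k.P m).map Complex.ofRealHom)
    (Sum.elim k.Q fun m => (k.Q m).map (starRingEnd ℂ))

/-- The permutation of the exponents by complex conjugation. -/
def conjIndex : k.Index → k.Index := Sum.map id Sum.swap

lemma conjIndex_involutive : Function.Involutive k.conjIndex := by
  rintro (m | m | m) <;> rfl

lemma exponent_conjIndex (i : k.Index) : k.exponent (k.conjIndex i) = conj (k.exponent i) := by
  rcases i with m | m | m <;> simp [exponent, conjIndex]

lemma poly_conjIndex (i : k.Index) : k.poly (k.conjIndex i) = (k.poly i).map (starRingEnd ℂ) := by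
  rcases i with m | m | m <;> ext n <;> simp [poly, conjIndex]

lemma exponent_re_pos (i : k.Index) : 0 < (k.exponent i).re := by
  rcases i with m | m | m
  · simpa [exponent] using k.α_pos m
  · simpa [exponent] using k.γ_re m
  · simpa [exponent] using k.γ_re m

lemma exponent_injective : Function.Injective k.exponent := by
  refine (Complex.ofReal_injective.comp k.α_inj).sumElim
    (k.γ_inj.sumElim ((starRingEnd ℂ).injective.comp k.γ_inj) fun m n h => ?_) fun m i h => ?_
  · have him := congrArg Complex.im h
    rw [Complex.conj_im] at him
    linarith [k.γ_im m, k.γ_im n]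
  · have him := congrArg Complex.im h
    rcases i with n | n
    · exact (k.γ_im n).ne him
    · exact (k.γ_im n).ne' (by simpa using him.symm)

lemma poly_ne_zero (i : k.Index) : k.poly i ≠ 0 := by
  rcases i with m | m | m
  · simpa [poly, Polynomial.map_eq_zero] using k.P_ne m
  · simpa [poly] using k.Q_ne m
  · simpa [poly, Polynomial.map_eq_zero] using k.Q_ne m

lemma natDegree_poly_conjIndex (i : k.Index) :
    (k.poly (k.conjIndex i)).natDegree = (k.poly i).natDegree := by
  rw [poly_conjIndex, Polynomial.natDegree_map]

lemma kernel_eq : k.kernel = fun t => ∑ i, expPoly (k.exponent i) (k.poly i) t := by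
  have heval (t : ℝ) (m) : ((k.Q m).map (starRingEnd ℂ)).eval (t : ℂ) = conj ((k.Q m).eval ↑t) := by
    simpa using (k.Q m).eval_map_apply (starRingEnd ℂ) (t : ℂ)
  have heval' (t : ℝ) (m) : ((k.P m).map Complex.ofRealHom).eval (t : ℂ) = ((k.P m).eval t : ℝ) :=
    (k.P m).eval_map_apply Complex.ofRealHom t
  ext t
  simp [kernel, expPoly, exponent, poly, heval, heval', Finset.sum_add_distrib]

/-- The number of functionals `⟪t ^ a e^{-βt}, ·⟫`, `a = 0, 1, …`, for each exponent `β`, on whose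
common kernel the operator is non-negative. Of two complex conjugate exponents only one needs to
be taken into account, as the form of the operator couples each of them only with the other. -/
noncomputable def negCut : k.Index → ℕ :=
  Sum.elim (fun m => negNumber (k.P m)) (Sum.elim (fun m => (k.Q m).natDegree + 1) fun _ => 0)

lemma sum_negCut : ∑ i, k.negCut i = k.totalNeg := by
  simp [negCut, totalNeg, Finset.sum_add_distrib, add_assoc]

/-- The data of the kernel `-v`. -/
noncomputable def neg : FiniteRankKernel :=
  { k with
    P := fun m => -k.P m
    Q := fun m => -k.Q m
    P_ne := fun m => neg_ne_zero.2 (k.P_ne m)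
    Q_ne := fun m => neg_ne_zero.2 (k.Q_ne m) }

lemma kernel_neg : k.neg.kernel = -k.kernel := by
  ext t
  simp only [kernel, neg, Pi.neg_apply, Polynomial.eval_neg, Complex.ofReal_neg, map_neg, neg_mul,
    neg_add, ← Finset.sum_neg_distrib]
  rfl

lemma totalNeg_add_totalNeg_neg :
    k.totalNeg + k.neg.totalNeg = ∑ i, ((k.poly i).natDegree + 1) := by
  have hreal : ∑ m, negNumber (k.P m) + ∑ m, negNumber (-k.P m) =
      ∑ m, ((k.P m).natDegree + 1) := by
    rw [← Finset.sum_add_distrib]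
    exact Finset.sum_congr rfl fun m _ => negNumber_add_negNumber_neg (k.P_ne m)
  have hneg : k.neg.totalNeg = ∑ m, negNumber (-k.P m) + ∑ m, (k.Q m).natDegree + k.M₁ := by
    simp only [totalNeg, neg, Polynomial.natDegree_neg]
    rfl
  rw [hneg, totalNeg]
  simp only [poly, Fintype.sum_sum_type, Sum.elim_inl, Sum.elim_inr,
    Polynomial.natDegree_map, ← hreal]
  simp only [Finset.sum_add_distrib, Finset.sum_const, Finset.card_univ, Fintype.card_fin,
    smul_eq_mul, mul_one]
  ring

/-- The linear span of the functions `t ^ a e^{-βt}` that make up the range of the operator. -/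
noncomputable def rangeSpan : Submodule ℂ L2Plus :=
  Submodule.span ℂ (Set.range fun p : Σ i, Fin ((k.poly i).natDegree + 1) =>
    expVec (k.exponent p.1) p.2)

lemma expVec_mem_rangeSpan (i : k.Index) {a : ℕ} (ha : a < (k.poly i).natDegree + 1) :
    expVec (k.exponent i) a ∈ k.rangeSpan :=
  Submodule.subset_span ⟨⟨i, ⟨a, ha⟩⟩, rfl⟩

instance : FiniteDimensional ℂ k.rangeSpan :=
  FiniteDimensional.span_of_finite ℂ (Set.finite_range _)

lemma linearIndependent_expVec_exponent :
    LinearIndependent ℂ fun p : Σ i, Fin ((k.poly i).natDegree + 1) =>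
      expVec (k.exponent p.1) p.2 :=
  linearIndependent_expVec k.exponent_re_pos k.exponent_injective _

lemma finrank_rangeSpan : Module.finrank ℂ k.rangeSpan = ∑ i, ((k.poly i).natDegree + 1) := by
  rw [rangeSpan, finrank_span_eq_card k.linearIndependent_expVec_exponent]
  simp

variable {V : L2Plus →L[ℂ] L2Plus}

lemma isSelfAdjoint (hV : IsHankelIntegralOperator V k.kernel) : IsSelfAdjoint V := by
  rw [kernel_eq] at hV
  rw [ContinuousLinearMap.isSelfAdjoint_iff_isSymmetric]
  intro f g
  rw [ContinuousLinearMap.coe_coe, ← inner_conj_symm, inner_hankel_apply k.exponent_re_pos hV,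
    inner_hankel_apply k.exponent_re_pos hV, map_sum,
    ← Equiv.sum_comp k.conjIndex_involutive.toPerm]
  refine Finset.sum_congr rfl fun i _ => ?_
  rw [map_hankelForm (starRingEnd ℂ).injective, hankelForm_comm, Function.Involutive.coe_toPerm,
    ← poly_conjIndex, k.conjIndex_involutive i]
  simp only [Function.comp_def, exponent_conjIndex, inner_conj_symm, Complex.conj_conj]

lemma re_inner_nonneg (hV : IsHankelIntegralOperator V k.kernel) {f : L2Plus}
    (hf : ∀ i, ∀ a < k.negCut i, ⟪expVec (k.exponent i) a, f⟫_ℂ = 0) :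
    0 ≤ (⟪f, V f⟫_ℂ).re := by
  have hf' : ∀ i, ∀ a < k.negCut i, ⟪f, expVec (k.exponent i) a⟫_ℂ = 0 := fun i a ha =>
    inner_eq_zero_symm.1 (hf i a ha)
  rw [kernel_eq] at hV
  rw [inner_hankel_apply k.exponent_re_pos hV, Complex.re_sum]
  simp only [← exponent_conjIndex]
  refine Finset.sum_nonneg fun i _ => ?_
  rcases i with m | m | m
  · have hreal := re_hankelForm_nonneg (hf (.inl m))
    simp only [inner_conj_symm] at hreal
    exact hreal
  · refine (congrArg Complex.re (hankelForm_eq_zero (r := 0) ?_ (by simp)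
      (hf' (.inr (.inl m))))).ge
    simp [poly, negCut]
  · refine (congrArg Complex.re (hankelForm_eq_zero (r' := 0) ?_
      (hf (.inr (.inl m))) (by simp))).ge
    simp [poly, negCut]

theorem nminus_add_le (hV : IsHankelIntegralOperator V k.kernel) {A : L2Plus →L[ℂ] L2Plus}
    (hA : IsSelfAdjoint A) (hpos : ∀ f, 0 ≤ (⟪f, A f⟫_ℂ).re) : Nminus (A + V) ≤ k.totalNeg := by
  let J : L2Plus →ₗ[ℂ] ((Σ i, Fin (k.negCut i)) → ℂ) :=
    LinearMap.pi fun p => innerₛₗ ℂ (expVec (k.exponent p.1) (p.2 : ℕ))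
  refine (nminus_le_finrank (hA.add (k.isSelfAdjoint hV)) J fun f hf => ?_).trans_eq ?_
  · rw [add_apply, inner_add_right, Complex.add_re]
    exact add_nonneg (hpos f) (k.re_inner_nonneg hV fun i a ha => congrFun hf ⟨i, ⟨a, ha⟩⟩)
  · simp [← sum_negCut]

lemma range_le_rangeSpan (hV : IsHankelIntegralOperator V k.kernel) :
    (V : L2Plus →ₗ[ℂ] L2Plus).range ≤ k.rangeSpan := by
  rintro _ ⟨f, rfl⟩
  rw [kernel_eq] at hV
  rw [ContinuousLinearMap.coe_coe, hankel_apply k.exponent_re_pos hV]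
  exact Submodule.sum_mem _ fun p _ =>
    Submodule.smul_mem _ _ (Submodule.subset_span (Set.mem_range_self p))

lemma finiteDimensional_range (hV : IsHankelIntegralOperator V k.kernel) :
    FiniteDimensional ℂ (V : L2Plus →ₗ[ℂ] L2Plus).range :=
  Submodule.finiteDimensional_of_le (k.range_le_rangeSpan hV)

lemma ker_le_orthogonal_rangeSpan (hV : IsHankelIntegralOperator V k.kernel) :
    (V : L2Plus →ₗ[ℂ] L2Plus).ker ≤ k.rangeSpanᗮ := by
  rw [kernel_eq] at hV
  rw [Submodule.le_orthogonal_iff_le_orthogonal, rangeSpan, Submodule.span_le]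
  rintro _ ⟨⟨i, a⟩, rfl⟩
  refine (Submodule.mem_orthogonal' _ _).2 fun f (hf : V f = 0) => ?_
  rw [hankel_apply k.exponent_re_pos hV] at hf
  have hmulVec := Fintype.linearIndependent_iff.1 k.linearIndependent_expVec_exponent _ hf
  have hzero := eq_zero_of_addMulVec_eq_zero (k.poly_ne_zero (k.conjIndex i))
    (x := fun a => ⟪expVec (conj (k.exponent (k.conjIndex i))) a, f⟫_ℂ)
    (fun b hb => hmulVec ⟨k.conjIndex i, ⟨b, Nat.lt_succ_of_le hb⟩⟩) a
      (by rw [natDegree_poly_conjIndex]; exact Nat.lt_succ_iff.1 a.2)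
  simpa [exponent_conjIndex] using hzero

lemma finrank_rangeSpan_le_rank (hV : IsHankelIntegralOperator V k.kernel) :
    (Module.finrank ℂ k.rangeSpan : ℕ∞) ≤
      Cardinal.toENat (Module.rank ℂ (V : L2Plus →ₗ[ℂ] L2Plus).range) := by
  have hdisj : Disjoint k.rangeSpan (V : L2Plus →ₗ[ℂ] L2Plus).ker :=
    (Submodule.orthogonal_disjoint _).mono_right (k.ker_le_orthogonal_rangeSpan hV)
  have hinj : Function.Injective
      ((V : L2Plus →ₗ[ℂ] L2Plus).rangeRestrict ∘ₗ k.rangeSpan.subtype) := by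
    rw [← LinearMap.ker_eq_bot, LinearMap.ker_comp, LinearMap.ker_rangeRestrict,
      ← Submodule.disjoint_iff_comap_eq_bot]
    exact hdisj
  have h := OrderHomClass.mono Cardinal.toENat (LinearMap.rank_le_of_injective _ hinj)
  rwa [← Module.finrank_eq_rank ℂ k.rangeSpan, Cardinal.toENat_nat] at h

theorem nminus_eq (hV : IsHankelIntegralOperator V k.kernel) : Nminus V = k.totalNeg := by
  have hle (k : FiniteRankKernel) {V : L2Plus →L[ℂ] L2Plus}
      (hV : IsHankelIntegralOperator V k.kernel) : Nminus V ≤ k.totalNeg := by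
    simpa using k.nminus_add_le hV (IsSelfAdjoint.zero _) (by simp)
  refine le_antisymm (hle k hV) ?_
  have hneg : Nminus (-V) ≤ k.neg.totalNeg := hle k.neg (k.kernel_neg ▸ hV.neg)
  refine (ENat.add_le_add_iff_right (ENat.natCast_ne_top k.neg.totalNeg)).1 ?_
  calc (k.totalNeg + k.neg.totalNeg : ℕ∞)
      = Module.finrank ℂ k.rangeSpan := by
        rw [finrank_rangeSpan, ← totalNeg_add_totalNeg_neg, Nat.cast_add]
    _ ≤ _ := k.finrank_rangeSpan_le_rank hV
    _ ≤ Nminus V + Nminus (-V) := rank_range_le_nminus_add_nminus_neg (k.isSelfAdjoint hV)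
    _ ≤ Nminus V + k.neg.totalNeg := by gcongr

end FiniteRankKernel

/-! ### The Laplace transform on `L²(ℝ₊)` -/

section LaplaceTransform

open scoped ENNReal

lemma sq_lintegral_mul_le {α : Type*} [MeasurableSpace α] {μ : Measure α} {k q φ : α → ℝ≥0∞}
    (hk : AEMeasurable k μ) (hq : AEMeasurable q μ) (hφ : AEMeasurable φ μ)
    (hq₀ : ∀ᵐ s ∂μ, q s ≠ 0) (hq_top : ∀ᵐ s ∂μ, q s ≠ ⊤) :
    (∫⁻ s, k s * φ s ∂μ) ^ 2 ≤ (∫⁻ s, k s * q s ∂μ) * ∫⁻ s, k s * (φ s ^ 2 / q s) ∂μ := by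
  have hsplit : ∀ᵐ s ∂μ,
      (k s * q s) ^ (1 / 2 : ℝ) * (k s * (φ s ^ 2 / q s)) ^ (1 / 2 : ℝ) = k s * φ s := by
    filter_upwards [hq₀, hq_top] with s h₀ h_top
    have hsq : k s * q s * (k s * (φ s ^ 2 / q s)) = (k s * φ s) ^ (2 : ℝ) := by
      calc k s * q s * (k s * (φ s ^ 2 / q s)) = (k s * φ s) ^ 2 * (q s * (q s)⁻¹) := by
            rw [div_eq_mul_inv]; ring
        _ = (k s * φ s) ^ (2 : ℝ) := by
            rw [ENNReal.mul_inv_cancel h₀ h_top, mul_one, ENNReal.rpow_two]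
    rw [← ENNReal.mul_rpow_of_nonneg _ _ (by norm_num), hsq, ← ENNReal.rpow_mul]
    norm_num
  have hholder := ENNReal.lintegral_mul_norm_pow_le (hk.mul hq) (hk.mul ((hφ.pow_const 2).div hq))
    (p := 1 / 2) (q := 1 / 2) (by norm_num) (by norm_num) (by norm_num)
  simp only [Pi.mul_apply, Pi.div_apply] at hholder
  rw [lintegral_congr_ae hsplit, ← ENNReal.mul_rpow_of_nonneg _ _ (by norm_num)] at hholder
  calc (∫⁻ s, k s * φ s ∂μ) ^ 2
      ≤ (((∫⁻ s, k s * q s ∂μ) * ∫⁻ s, k s * (φ s ^ 2 / q s) ∂μ) ^ (1 / 2 : ℝ)) ^ 2 := by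
        gcongr
    _ = (∫⁻ s, k s * q s ∂μ) * ∫⁻ s, k s * (φ s ^ 2 / q s) ∂μ := by
        rw [← ENNReal.rpow_two, ← ENNReal.rpow_mul]
        norm_num

theorem lintegral_sq_le_of_schur_test {α β : Type*} [MeasurableSpace α] [MeasurableSpace β]
    {μ : Measure α} {ν : Measure β} [SFinite μ] [SFinite ν] {k : α → β → ℝ≥0∞}
    (hk : Measurable (Function.uncurry k)) {p : α → ℝ≥0∞} {q φ : β → ℝ≥0∞}
    (hp : AEMeasurable p μ) (hq : AEMeasurable q ν) (hφ : AEMeasurable φ ν)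
    (hq₀ : ∀ᵐ s ∂ν, q s ≠ 0) (hq_top : ∀ᵐ s ∂ν, q s ≠ ⊤) {B C : ℝ≥0∞}
    (hB : ∀ᵐ t ∂μ, ∫⁻ s, k t s * q s ∂ν ≤ B * p t)
    (hC : ∀ᵐ s ∂ν, ∫⁻ t, k t s * p t ∂μ ≤ C * q s) :
    ∫⁻ t, (∫⁻ s, k t s * φ s ∂ν) ^ 2 ∂μ ≤ B * C * ∫⁻ s, φ s ^ 2 ∂ν := by
  have hk₁ (t : α) : Measurable (k t) := hk.comp measurable_prodMk_left
  have hk₂ (s : β) : Measurable fun t => k t s := hk.comp measurable_prodMk_right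
  have hψ : AEMeasurable (fun s => φ s ^ 2 / q s) ν := (hφ.pow_const 2).div hq
  calc ∫⁻ t, (∫⁻ s, k t s * φ s ∂ν) ^ 2 ∂μ
      ≤ ∫⁻ t, ∫⁻ s, B * p t * (k t s * (φ s ^ 2 / q s)) ∂ν ∂μ := by
        refine lintegral_mono_ae ?_
        filter_upwards [hB] with t ht
        rw [lintegral_const_mul'' (B * p t) (by exact (hk₁ t).aemeasurable.mul hψ)]
        exact (sq_lintegral_mul_le (hk₁ t).aemeasurable hq hφ hq₀ hq_top).trans (by gcongr)
    _ = ∫⁻ s, ∫⁻ t, B * p t * (k t s * (φ s ^ 2 / q s)) ∂μ ∂ν :=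
        lintegral_lintegral_swap <| by
          exact (hp.comp_fst.const_mul B).mul (hk.aemeasurable.mul hψ.comp_snd)
    _ ≤ ∫⁻ s, B * C * φ s ^ 2 ∂ν := by
        refine lintegral_mono_ae ?_
        filter_upwards [hC, hq₀, hq_top] with s hs h₀ h_top
        calc ∫⁻ t, B * p t * (k t s * (φ s ^ 2 / q s)) ∂μ
            = B * (φ s ^ 2 / q s) * ∫⁻ t, k t s * p t ∂μ := by
              rw [← lintegral_const_mul'' _ (by exact (hk₂ s).aemeasurable.mul hp)]
              exact lintegral_congr fun t => by ring
          _ ≤ B * (φ s ^ 2 / q s) * (C * q s) := by gcongr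
          _ = B * C * φ s ^ 2 * ((q s)⁻¹ * q s) := by rw [div_eq_mul_inv]; ring
          _ = B * C * φ s ^ 2 := by rw [ENNReal.inv_mul_cancel h₀ h_top, mul_one]
    _ = B * C * ∫⁻ s, φ s ^ 2 ∂ν := lintegral_const_mul'' _ (hφ.pow_const 2)

lemma eLpNorm_two_sq {α E : Type*} [MeasurableSpace α] [NormedAddCommGroup E] (f : α → E)
    (μ : Measure α) : eLpNorm f 2 μ ^ 2 = ∫⁻ a, ‖f a‖ₑ ^ 2 ∂μ := by
  simpa using eLpNorm_nnreal_pow_eq_lintegral (μ := μ) (f := f) (p := 2) two_ne_zero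

/-- The Laplace transform of a function on `ℝ₊`. -/
noncomputable def laplaceFun (f : ℝ → ℂ) (t : ℝ) : ℂ :=
  ∫ s in Set.Ioi (0 : ℝ), Complex.exp (-(t * s : ℝ)) * f s

lemma integrableOn_rpow_neg_half_mul_exp_neg_mul {t : ℝ} (ht : 0 < t) :
    IntegrableOn (fun s : ℝ => s ^ (-(1 / 2) : ℝ) * Real.exp (-(t * s))) (Set.Ioi 0) := by
  simpa using integrableOn_rpow_mul_exp_neg_mul_rpow (s := (-(1 / 2) : ℝ)) (p := 1) (b := t)
    (by norm_num) one_pos ht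

lemma lintegral_exp_mul_rpow_neg_half {t : ℝ} (ht : 0 < t) :
    ∫⁻ s in Set.Ioi (0 : ℝ), ENNReal.ofReal (Real.exp (-(t * s))) *
        ENNReal.ofReal (s ^ (-(1 / 2) : ℝ)) =
      ENNReal.ofReal (√Real.pi) * ENNReal.ofReal (t ^ (-(1 / 2) : ℝ)) := by
  have hgamma := Real.integral_rpow_mul_exp_neg_mul_Ioi (a := 1 / 2) (by norm_num) ht
  rw [Real.Gamma_one_half_eq, one_div t, Real.inv_rpow ht.le, ← Real.rpow_neg ht.le,
    show (1 / 2 - 1 : ℝ) = -(1 / 2) by norm_num] at hgamma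
  calc ∫⁻ s in Set.Ioi (0 : ℝ), ENNReal.ofReal (Real.exp (-(t * s))) *
        ENNReal.ofReal (s ^ (-(1 / 2) : ℝ))
      = ∫⁻ s in Set.Ioi (0 : ℝ), ENNReal.ofReal (s ^ (-(1 / 2) : ℝ) * Real.exp (-(t * s))) :=
        lintegral_congr fun s => by
          rw [mul_comm (s ^ _), ENNReal.ofReal_mul (Real.exp_pos _).le]
    _ = ENNReal.ofReal (∫ s in Set.Ioi (0 : ℝ), s ^ (-(1 / 2) : ℝ) * Real.exp (-(t * s))) := by
        refine (ofReal_integral_eq_lintegral_ofReal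
          (integrableOn_rpow_neg_half_mul_exp_neg_mul ht) ?_).symm
        filter_upwards [ae_restrict_mem measurableSet_Ioi] with s hs
        exact mul_nonneg (Real.rpow_nonneg (Set.mem_Ioi.1 hs).le _) (Real.exp_pos _).le
    _ = ENNReal.ofReal (√Real.pi) * ENNReal.ofReal (t ^ (-(1 / 2) : ℝ)) := by
        rw [hgamma, mul_comm, ENNReal.ofReal_mul (Real.sqrt_nonneg _)]

lemma lintegral_sq_lintegral_exp_mul_le {φ : ℝ → ℝ≥0∞}
    (hφ : AEMeasurable φ (volume.restrict (Set.Ioi (0 : ℝ)))) :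
    ∫⁻ t in Set.Ioi (0 : ℝ), (∫⁻ s in Set.Ioi (0 : ℝ),
      ENNReal.ofReal (Real.exp (-(t * s))) * φ s) ^ 2 ≤
      ENNReal.ofReal Real.pi * ∫⁻ s in Set.Ioi (0 : ℝ), φ s ^ 2 := by
  have hweight : ∀ᵐ t ∂volume.restrict (Set.Ioi (0 : ℝ)), ∫⁻ s in Set.Ioi (0 : ℝ),
      ENNReal.ofReal (Real.exp (-(t * s))) * ENNReal.ofReal (s ^ (-(1 / 2) : ℝ)) ≤
        ENNReal.ofReal (√Real.pi) * ENNReal.ofReal (t ^ (-(1 / 2) : ℝ)) := by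
    filter_upwards [ae_restrict_mem measurableSet_Ioi] with t ht
    exact (lintegral_exp_mul_rpow_neg_half ht).le
  have h := lintegral_sq_le_of_schur_test (μ := volume.restrict (Set.Ioi (0 : ℝ)))
    (k := fun t s : ℝ => ENNReal.ofReal (Real.exp (-(t * s)))) (by fun_prop)
    (p := fun t => ENNReal.ofReal (t ^ (-(1 / 2) : ℝ))) (by fun_prop) (by fun_prop) hφ
    (by
      filter_upwards [ae_restrict_mem measurableSet_Ioi] with s hs
      exact (ENNReal.ofReal_pos.2 (Real.rpow_pos_of_pos hs _)).ne')
    (ae_of_all _ fun _ => ENNReal.ofReal_ne_top) hweight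
    (by
      filter_upwards [hweight] with s hs
      simpa only [mul_comm s] using hs)
  rwa [← ENNReal.ofReal_mul (Real.sqrt_nonneg _), Real.mul_self_sqrt Real.pi_pos.le] at h

lemma aestronglyMeasurable_laplaceFun {f : ℝ → ℂ}
    (hf : AEStronglyMeasurable f (volume.restrict (Set.Ioi (0 : ℝ)))) :
    AEStronglyMeasurable (laplaceFun f) (volume.restrict (Set.Ioi (0 : ℝ))) := by
  refine AEStronglyMeasurable.integral_prod_right'
    (f := fun p : ℝ × ℝ => Complex.exp (-(p.1 * p.2 : ℝ)) * f p.2) ?_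
  exact (by fun_prop : Continuous fun p : ℝ × ℝ =>
    Complex.exp (-(p.1 * p.2 : ℝ))).aestronglyMeasurable.mul hf.comp_snd

lemma enorm_exp_neg_ofReal (x : ℝ) :
    ‖Complex.exp (-(x : ℂ))‖ₑ = ENNReal.ofReal (Real.exp (-x)) := by
  rw [← Complex.ofReal_neg, ← Complex.ofReal_exp, ← ofReal_norm, Complex.norm_real,
    Real.norm_of_nonneg (Real.exp_pos _).le]

lemma eLpNorm_laplaceFun_le {f : ℝ → ℂ}
    (hf : AEStronglyMeasurable f (volume.restrict (Set.Ioi (0 : ℝ)))) :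
    eLpNorm (laplaceFun f) 2 (volume.restrict (Set.Ioi (0 : ℝ))) ≤
      ENNReal.ofReal (√Real.pi) * eLpNorm f 2 (volume.restrict (Set.Ioi (0 : ℝ))) := by
  rw [← ENNReal.pow_le_pow_left_iff two_ne_zero, mul_pow, eLpNorm_two_sq, eLpNorm_two_sq,
    ← ENNReal.ofReal_pow (Real.sqrt_nonneg _), Real.sq_sqrt Real.pi_pos.le]
  refine (lintegral_mono fun t => ?_).trans (lintegral_sq_lintegral_exp_mul_le hf.enorm)
  gcongr
  refine (enorm_integral_le_lintegral_enorm _).trans (lintegral_congr fun s => ?_).le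
  rw [enorm_mul, enorm_exp_neg_ofReal]

lemma memLp_laplaceFun (f : L2Plus) :
    MemLp (laplaceFun f) 2 (volume.restrict (Set.Ioi (0 : ℝ))) :=
  ⟨aestronglyMeasurable_laplaceFun (Lp.aestronglyMeasurable f),
    (eLpNorm_laplaceFun_le (Lp.aestronglyMeasurable f)).trans_lt
      (ENNReal.mul_lt_top ENNReal.ofReal_lt_top (Lp.memLp f).2)⟩

lemma laplaceFun_eq_inner (f : L2Plus) {t : ℝ} (ht : 0 < t) :
    laplaceFun f t = ⟪expVec t 0, f⟫_ℂ := by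
  have h := inner_expVec_conj (β := (t : ℂ)) (by simpa using ht) 0 f
  rw [Complex.conj_ofReal] at h
  simp [h, laplaceFun]

/-- The Laplace transform as a bounded operator on `L²(ℝ₊)`. -/
noncomputable def laplace : L2Plus →L[ℂ] L2Plus :=
  LinearMap.mkContinuous
    { toFun := fun f => (memLp_laplaceFun f).toLp _
      map_add' := fun f g => by
        rw [← MemLp.toLp_add, MemLp.toLp_eq_toLp_iff]
        filter_upwards [ae_restrict_mem measurableSet_Ioi] with t ht
        simp only [Pi.add_apply, laplaceFun_eq_inner _ ht, inner_add_right]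
      map_smul' := fun c f => by
        rw [RingHom.id_apply, ← MemLp.toLp_const_smul, MemLp.toLp_eq_toLp_iff]
        filter_upwards [ae_restrict_mem measurableSet_Ioi] with t ht
        simp only [Pi.smul_apply, laplaceFun_eq_inner _ ht, inner_smul_right, smul_eq_mul] }
    (√Real.pi) fun f => by
      simp only [LinearMap.coe_mk, AddHom.coe_mk]
      rw [Lp.norm_toLp, Lp.norm_def, ← ENNReal.toReal_ofReal (Real.sqrt_nonneg Real.pi),
        ← ENNReal.toReal_mul]
      exact ENNReal.toReal_mono (ENNReal.mul_lt_top ENNReal.ofReal_lt_top (Lp.memLp f).2).ne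
        (eLpNorm_laplaceFun_le (Lp.aestronglyMeasurable f))

lemma coeFn_laplace (f : L2Plus) :
    laplace f =ᵐ[volume.restrict (Set.Ioi (0 : ℝ))] laplaceFun f :=
  MemLp.coeFn_toLp (memLp_laplaceFun f)

lemma integrable_laplace_kernel (f g : L2Plus) :
    Integrable (Function.uncurry fun t s : ℝ => conj (g t) * (Complex.exp (-(t * s : ℝ)) * f s))
      ((volume.restrict (Set.Ioi (0 : ℝ))).prod (volume.restrict (Set.Ioi (0 : ℝ)))) := by
  have hf := Lp.aestronglyMeasurable f
  have hg := Lp.aestronglyMeasurable g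
  have hmeas : AEStronglyMeasurable
      (Function.uncurry fun t s : ℝ => conj (g t) * (Complex.exp (-(t * s : ℝ)) * f s))
      ((volume.restrict (Set.Ioi (0 : ℝ))).prod (volume.restrict (Set.Ioi (0 : ℝ)))) :=
    (Complex.continuous_conj.comp_aestronglyMeasurable hg.comp_fst).mul <|
      (by fun_prop : Continuous fun p : ℝ × ℝ =>
        Complex.exp (-(p.1 * p.2 : ℝ))).aestronglyMeasurable.mul hf.comp_snd
  refine ⟨hmeas, ?_⟩
  rw [HasFiniteIntegral, lintegral_prod _ hmeas.enorm]
  calc ∫⁻ t in Set.Ioi (0 : ℝ), ∫⁻ s in Set.Ioi (0 : ℝ),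
        ‖conj (g t) * (Complex.exp (-(t * s : ℝ)) * f s)‖ₑ
      = ∫⁻ t in Set.Ioi (0 : ℝ), ‖g t‖ₑ * ∫⁻ s in Set.Ioi (0 : ℝ),
          ENNReal.ofReal (Real.exp (-(t * s))) * ‖f s‖ₑ := by
        refine lintegral_congr fun t => ?_
        rw [← lintegral_const_mul'' _ (by exact AEMeasurable.mul (by fun_prop) hf.enorm)]
        refine lintegral_congr fun s => ?_
        rw [enorm_mul, enorm_mul, enorm_exp_neg_ofReal, RCLike.enorm_conj]
    _ ≤ ∫⁻ t in Set.Ioi (0 : ℝ), (‖g t‖ₑ ^ 2 + (∫⁻ s in Set.Ioi (0 : ℝ),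
          ENNReal.ofReal (Real.exp (-(t * s))) * ‖f s‖ₑ) ^ 2) := by
        refine lintegral_mono fun t => ?_
        rw [sq, sq]
        rcases le_total ‖g t‖ₑ (∫⁻ s in Set.Ioi (0 : ℝ),
          ENNReal.ofReal (Real.exp (-(t * s))) * ‖f s‖ₑ) with h | h
        · exact le_add_left (by gcongr)
        · exact le_add_right (by gcongr)
    _ ≤ eLpNorm g 2 (volume.restrict (Set.Ioi (0 : ℝ))) ^ 2 +
          ENNReal.ofReal Real.pi * eLpNorm f 2 (volume.restrict (Set.Ioi (0 : ℝ))) ^ 2 := by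
        rw [lintegral_add_left' (hg.enorm.pow_const 2), eLpNorm_two_sq, eLpNorm_two_sq]
        gcongr
        exact lintegral_sq_lintegral_exp_mul_le hf.enorm
    _ < ⊤ := ENNReal.add_lt_top.2 ⟨ENNReal.pow_lt_top (Lp.memLp g).2,
        ENNReal.mul_lt_top ENNReal.ofReal_lt_top (ENNReal.pow_lt_top (Lp.memLp f).2)⟩

lemma isSelfAdjoint_laplace : IsSelfAdjoint laplace := by
  rw [ContinuousLinearMap.isSelfAdjoint_iff_isSymmetric]
  intro g f
  simp only [ContinuousLinearMap.coe_coe]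
  calc ⟪laplace g, f⟫_ℂ = ∫ s in Set.Ioi (0 : ℝ), ∫ t in Set.Ioi (0 : ℝ),
        conj (g t) * (Complex.exp (-(t * s : ℝ)) * f s) := by
        rw [L2.inner_def]
        refine integral_congr_ae ?_
        filter_upwards [coeFn_laplace g] with s hs
        rw [hs, RCLike.inner_apply', laplaceFun, ← integral_conj, ← integral_mul_const]
        refine integral_congr_ae (ae_of_all _ fun t => ?_)
        simp only [map_mul, ← Complex.exp_conj, map_neg, Complex.conj_ofReal, mul_comm s t]
        ring
    _ = ∫ t in Set.Ioi (0 : ℝ), ∫ s in Set.Ioi (0 : ℝ),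
        conj (g t) * (Complex.exp (-(t * s : ℝ)) * f s) :=
        (integral_integral_swap (integrable_laplace_kernel f g)).symm
    _ = ⟪g, laplace f⟫_ℂ := by
        rw [L2.inner_def]
        refine integral_congr_ae ?_
        filter_upwards [coeFn_laplace f] with t ht
        rw [ht, RCLike.inner_apply', laplaceFun, integral_const_mul]

lemma memLp_exp_neg_mul (f : L2Plus) :
    MemLp (fun s : ℝ => Complex.exp (-(s : ℂ)) * f s) 2 (volume.restrict (Set.Ioi (0 : ℝ))) := by
  refine MemLp.of_le (Lp.memLp f)
    ((by fun_prop : Continuous fun s : ℝ => Complex.exp (-(s : ℂ))).aestronglyMeasurable.mul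
      (Lp.aestronglyMeasurable f)) ?_
  filter_upwards [ae_restrict_mem measurableSet_Ioi] with s hs
  rw [norm_mul, Complex.norm_exp]
  refine mul_le_of_le_one_left (norm_nonneg _) ?_
  simpa using (Set.mem_Ioi.1 hs).le

/-- Multiplication by `e^{-s}` on `L²(ℝ₊)`, which the Laplace transform intertwines with the shift
`shiftOne`. -/
noncomputable def mulExpNeg : L2Plus →ₗ[ℂ] L2Plus where
  toFun f := (memLp_exp_neg_mul f).toLp _
  map_add' f g := by
    rw [← MemLp.toLp_add, MemLp.toLp_eq_toLp_iff]
    filter_upwards [Lp.coeFn_add f g] with s hs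
    simp only [hs, Pi.add_apply, mul_add]
  map_smul' c f := by
    rw [RingHom.id_apply, ← MemLp.toLp_const_smul, MemLp.toLp_eq_toLp_iff]
    filter_upwards [Lp.coeFn_smul c f] with s hs
    simp only [hs, Pi.smul_apply, smul_eq_mul, mul_left_comm]

lemma coeFn_mulExpNeg (f : L2Plus) :
    mulExpNeg f =ᵐ[volume.restrict (Set.Ioi (0 : ℝ))] fun s : ℝ => Complex.exp (-(s : ℂ)) * f s :=
  MemLp.coeFn_toLp (memLp_exp_neg_mul f)

lemma eq_zero_of_mulExpNeg_eq_smul {f : L2Plus} {c : ℂ} (h : mulExpNeg f = c • f) : f = 0 := by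
  have hne : ∀ᵐ s : ℝ ∂volume.restrict (Set.Ioi (0 : ℝ)), Complex.exp (-(s : ℂ)) ≠ c := by
    refine ae_restrict_of_ae (Set.Subsingleton.measure_zero ?_ volume)
    intro x hx y hy
    simp only [Set.mem_compl_iff, Set.mem_ofPred_eq, not_not] at hx hy
    exact neg_injective (Real.exp_injective (Complex.ofReal_injective (by
      push_cast
      exact hx.trans hy.symm)))
  refine Lp.eq_zero_iff_ae_eq_zero.2 ?_
  filter_upwards [hne, h ▸ coeFn_mulExpNeg f, Lp.coeFn_smul c f] with s hs hmul hsmul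
  rw [hsmul, Pi.smul_apply, smul_eq_mul, ← sub_eq_zero, ← sub_mul] at hmul
  exact (mul_eq_zero.1 hmul).resolve_left (sub_ne_zero.2 hs.symm)

lemma measurePreserving_add_one : MeasurePreserving (fun t : ℝ => t + 1)
    (volume.restrict (Set.Ioi 0)) (volume.restrict (Set.Ioi 1)) := by
  simpa using (measurePreserving_add_right (volume : Measure ℝ) 1).restrict_preimage
    (measurableSet_Ioi (a := 1))

lemma ae_comp_add_one {p : ℝ → Prop} (h : ∀ᵐ t ∂volume.restrict (Set.Ioi (0 : ℝ)), p t) :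
    ∀ᵐ t ∂volume.restrict (Set.Ioi (0 : ℝ)), p (t + 1) :=
  measurePreserving_add_one.quasiMeasurePreserving.ae
    (ae_restrict_of_ae_restrict_of_subset (Set.Ioi_subset_Ioi zero_le_one) h)

lemma memLp_comp_add_one (f : L2Plus) :
    MemLp (fun t => f (t + 1)) 2 (volume.restrict (Set.Ioi (0 : ℝ))) :=
  ((Lp.memLp f).mono_measure (Measure.restrict_mono_set _
    (Set.Ioi_subset_Ioi zero_le_one))).comp_measurePreserving measurePreserving_add_one

/-- The shift `f ↦ f(· + 1)` on `L²(ℝ₊)`. -/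
noncomputable def shiftOne : L2Plus →ₗ[ℂ] L2Plus where
  toFun f := (memLp_comp_add_one f).toLp _
  map_add' f g := by
    rw [← MemLp.toLp_add, MemLp.toLp_eq_toLp_iff]
    exact ae_comp_add_one (Lp.coeFn_add f g)
  map_smul' c f := by
    rw [RingHom.id_apply, ← MemLp.toLp_const_smul, MemLp.toLp_eq_toLp_iff]
    exact ae_comp_add_one (Lp.coeFn_smul c f)

lemma coeFn_shiftOne (f : L2Plus) :
    shiftOne f =ᵐ[volume.restrict (Set.Ioi (0 : ℝ))] fun t => f (t + 1) :=
  MemLp.coeFn_toLp (memLp_comp_add_one f)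

lemma laplace_mulExpNeg (f : L2Plus) : laplace (mulExpNeg f) = shiftOne (laplace f) := by
  refine Lp.ext ?_
  filter_upwards [coeFn_laplace (mulExpNeg f), coeFn_shiftOne (laplace f),
    ae_comp_add_one (coeFn_laplace f)] with t hlhs hshift hrhs
  rw [hlhs, hshift, hrhs]
  refine integral_congr_ae ?_
  filter_upwards [coeFn_mulExpNeg f] with s hs
  rw [hs, ← mul_assoc, ← Complex.exp_add]
  congr 2
  push_cast
  ring

lemma shiftOne_expVec {β : ℂ} (hβ : 0 < β.re) (j : ℕ) :
    shiftOne (expVec β j) =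
      ∑ a ∈ Finset.range (j + 1), (Complex.exp (-β) * (j.choose a : ℂ)) • expVec β a := by
  refine Lp.ext ?_
  filter_upwards [coeFn_shiftOne (expVec β j), ae_comp_add_one (coeFn_expVec hβ j),
    Lp.coeFn_fun_finsetSum (Finset.range (j + 1)) fun a =>
      (Complex.exp (-β) * (j.choose a : ℂ)) • expVec β a,
    ae_all_iff.2 fun a => Lp.coeFn_smul (Complex.exp (-β) * (j.choose a : ℂ)) (expVec β a),
    ae_all_iff.2 fun a => coeFn_expVec hβ a] with t hshift hlhs hsum hsmul hexp
  rw [hshift, hlhs, hsum]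
  push_cast
  rw [add_pow, Finset.sum_mul]
  refine Finset.sum_congr rfl fun a _ => ?_
  rw [hsmul, Pi.smul_apply, hexp, smul_eq_mul, mul_add, neg_add, Complex.exp_add]
  simp only [one_pow, mul_one]
  ring

namespace FiniteRankKernel

lemma shiftOne_mem_rangeSpan (k : FiniteRankKernel) {f : L2Plus} (hf : f ∈ k.rangeSpan) :
    shiftOne f ∈ k.rangeSpan := by
  suffices h : k.rangeSpan ≤ k.rangeSpan.comap shiftOne from h hf
  refine Submodule.span_le.2 ?_
  rintro _ ⟨p, rfl⟩
  rw [SetLike.mem_coe, Submodule.mem_comap, shiftOne_expVec (k.exponent_re_pos _)]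
  exact Submodule.sum_mem _ fun a ha => Submodule.smul_mem _ _ (k.expVec_mem_rangeSpan p.1
    ((Nat.lt_succ_iff.1 (Finset.mem_range.1 ha)).trans_lt p.2.2))

/-- The preimage of `k.rangeSpan` would otherwise be a nonzero finite-dimensional space invariant
under multiplication by `e^{-s}`, which has no eigenvectors. -/
lemma eq_zero_of_laplace_mem_rangeSpan (k : FiniteRankKernel) (hinj : Function.Injective laplace)
    {g : L2Plus} (hg : laplace g ∈ k.rangeSpan) : g = 0 := by
  let W : Submodule ℂ L2Plus := k.rangeSpan.comap (laplace : L2Plus →ₗ[ℂ] L2Plus)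
  have hW : ∀ f ∈ W, mulExpNeg f ∈ W := fun f hf => by
    rw [Submodule.mem_comap, ContinuousLinearMap.coe_coe, laplace_mulExpNeg]
    exact k.shiftOne_mem_rangeSpan hf
  have : FiniteDimensional ℂ W :=
    FiniteDimensional.of_injective
      ((laplace : L2Plus →ₗ[ℂ] L2Plus).restrict (p := W) (q := k.rangeSpan) fun _ hf => hf)
      fun _ _ h => Subtype.ext (hinj (congrArg Subtype.val h))
  by_contra hg₀
  have : Nontrivial W := ⟨⟨⟨g, hg⟩, 0, fun h => hg₀ (congrArg Subtype.val h)⟩⟩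
  obtain ⟨c, hc⟩ := Module.End.exists_eigenvalue (mulExpNeg.restrict hW)
  obtain ⟨w, hw⟩ := hc.exists_hasEigenvector
  exact hw.2 (Subtype.ext (eq_zero_of_mulExpNeg_eq_smul (c := c)
    (congrArg Subtype.val hw.apply_eq_smul)))

end FiniteRankKernel

end LaplaceTransform

/-! ### The inverse Fourier transform of test functions -/

section TestFunctions

open scoped FourierTransform

lemma rpow_neg_half_mul_sqrt_two_pi :
    (2 * Real.pi) ^ (-(1 / 2) : ℝ) * √(2 * Real.pi) = 1 := by
  rw [Real.sqrt_eq_rpow, ← Real.rpow_add (by positivity)]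
  norm_num

/-- The entire extension `z ↦ (2π)^{-1/2} ∫ g(ξ) e^{izξ} dξ` of the inverse Fourier transform
`Φ* g`. -/
noncomputable def invPhi (g : ℝ → ℂ) (z : ℂ) : ℂ :=
  (((2 * Real.pi) ^ (-(1 / 2) : ℝ) : ℝ) : ℂ) * ∫ ξ : ℝ, g ξ * Complex.exp (Complex.I * z * ξ)

lemma norm_exp_I_mul (z : ℂ) (ξ : ℝ) :
    ‖Complex.exp (Complex.I * z * ξ)‖ = Real.exp (-(z.im * ξ)) := by
  simp [Complex.norm_exp]

lemma exp_neg_mul_le {a b R : ℝ} (ha : |a| ≤ R) : Real.exp (-(a * b)) ≤ Real.exp (R * |b|) := by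
  gcongr
  calc -(a * b) ≤ |a| * |b| := (neg_le_abs _).trans_eq (abs_mul a b)
    _ ≤ R * |b| := by gcongr

lemma integrable_mul_of_hasCompactSupport {g h : ℝ → ℂ} (hg : Continuous g)
    (hgc : HasCompactSupport g) (hh : Continuous h) : Integrable fun ξ => g ξ * h ξ :=
  (hg.mul hh).integrable_of_hasCompactSupport hgc.mul_right

lemma differentiable_invPhi {g : ℝ → ℂ} (hg : Continuous g) (hgc : HasCompactSupport g) :
    Differentiable ℂ (invPhi g) := by
  intro z₀
  refine DifferentiableAt.const_mul ?_ _
  refine (hasDerivAt_integral_of_dominated_loc_of_deriv_le (μ := volume)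
    (F := fun z (ξ : ℝ) => g ξ * Complex.exp (Complex.I * z * ξ))
    (F' := fun z (ξ : ℝ) => g ξ * (Complex.exp (Complex.I * z * ξ) * (Complex.I * 1 * ξ)))
    (bound := fun ξ => ‖g ξ‖ * (Real.exp ((|z₀.im| + 1) * |ξ|) * |ξ|))
    (Metric.ball_mem_nhds z₀ one_pos)
    (Filter.Eventually.of_forall fun z => Continuous.aestronglyMeasurable (by fun_prop))
    (integrable_mul_of_hasCompactSupport hg hgc (by fun_prop))
    (Continuous.aestronglyMeasurable (by fun_prop)) (ae_of_all _ fun ξ z hz => ?_)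
    (Continuous.integrable_of_hasCompactSupport (by fun_prop) hgc.norm.mul_right)
    (ae_of_all _ fun ξ z _ => ?_)).2.differentiableAt
  · have him : |z.im| ≤ |z₀.im| + 1 := by
      have hdist : |z.im - z₀.im| ≤ ‖z - z₀‖ := Complex.abs_im_le_norm (z - z₀)
      have hball : ‖z - z₀‖ < 1 := by simpa [dist_eq_norm] using hz
      linarith [abs_sub_abs_le_abs_sub z.im z₀.im]
    rw [norm_mul, norm_mul, norm_exp_I_mul, mul_one, norm_mul, Complex.norm_I, one_mul,
      Complex.norm_real, Real.norm_eq_abs]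
    exact mul_le_mul_of_nonneg_left (mul_le_mul_of_nonneg_right (exp_neg_mul_le him)
      (abs_nonneg ξ)) (norm_nonneg _)
  · exact ((((hasDerivAt_id z).const_mul Complex.I).mul_const (ξ : ℂ)).cexp).const_mul (g ξ)

lemma invPhi_deriv {g : ℝ → ℂ} (hg : ContDiff ℝ ∞ g) (hgc : HasCompactSupport g) (z : ℂ) :
    invPhi (deriv g) z = -(Complex.I * z) * invPhi g z := by
  have hexp (ξ : ℝ) : HasDerivAt (fun ξ : ℝ => Complex.exp (Complex.I * z * ξ))
      (Complex.exp (Complex.I * z * ξ) * (Complex.I * z * 1)) ξ :=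
    (((hasDerivAt_id (ξ : ℂ)).const_mul (Complex.I * z)).cexp).comp_ofReal
  have hparts := integral_mul_deriv_eq_deriv_mul_of_integrable (u := g)
    (fun ξ _ => (hg.differentiable (by simp) ξ).hasDerivAt) (fun ξ _ => hexp ξ)
    (integrable_mul_of_hasCompactSupport hg.continuous hgc (by fun_prop))
    (integrable_mul_of_hasCompactSupport (hg.continuous_deriv (by simp)) hgc.deriv (by fun_prop))
    (integrable_mul_of_hasCompactSupport hg.continuous hgc (by fun_prop))
  have hfactor : ∫ ξ : ℝ, g ξ * (Complex.exp (Complex.I * z * ξ) * (Complex.I * z * 1)) =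
      Complex.I * z * ∫ ξ : ℝ, g ξ * Complex.exp (Complex.I * z * ξ) := by
    rw [← integral_const_mul]
    exact integral_congr_ae (ae_of_all _ fun ξ => by ring)
  rw [invPhi, invPhi, ← neg_eq_iff_eq_neg.2 hparts, hfactor]
  ring

lemma exists_norm_invPhi_le {g : ℝ → ℂ} {r : ℝ} (hg : Continuous g) (hgc : HasCompactSupport g)
    (hr : ∀ ξ ∈ tsupport g, |ξ| ≤ r) :
    ∃ C : ℝ, ∀ z : ℂ, ‖invPhi g z‖ ≤ C * Real.exp (r * |z.im|) := by
  refine ⟨‖(((2 * Real.pi) ^ (-(1 / 2) : ℝ) : ℝ) : ℂ)‖ * ∫ ξ, ‖g ξ‖, fun z => ?_⟩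
  rw [invPhi, norm_mul, mul_assoc]
  refine mul_le_mul_of_nonneg_left ?_ (norm_nonneg _)
  rw [← integral_mul_const]
  refine norm_integral_le_of_norm_le
    ((hg.norm.integrable_of_hasCompactSupport hgc.norm).mul_const _) (ae_of_all _ fun ξ => ?_)
  rw [norm_mul, norm_exp_I_mul, mul_comm z.im]
  by_cases hξ : ξ ∈ tsupport g
  · exact mul_le_mul_of_nonneg_left (exp_neg_mul_le (hr ξ hξ)) (norm_nonneg _)
  · simp [image_eq_zero_of_notMem_tsupport hξ]

lemma exists_pow_mul_norm_invPhi_le {g : ℝ → ℂ} {r : ℝ} (hg : ContDiff ℝ ∞ g)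
    (hgc : HasCompactSupport g) (hr : ∀ ξ ∈ tsupport g, |ξ| ≤ r) (n : ℕ) :
    ∃ C : ℝ, ∀ z : ℂ, (1 + ‖z‖) ^ n * ‖invPhi g z‖ ≤ C * Real.exp (r * |z.im|) := by
  induction n generalizing g with
  | zero => simpa only [pow_zero, one_mul] using exists_norm_invPhi_le hg.continuous hgc hr
  | succ n ih =>
    obtain ⟨C, hC⟩ := ih hg hgc hr
    have hg' : ContDiff ℝ ∞ (deriv g) := by simpa using hg.iterate_deriv 1
    obtain ⟨D, hD⟩ := ih hg' hgc.deriv fun ξ hξ =>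
      hr ξ (closure_minimal support_deriv_subset isClosed_closure hξ)
    refine ⟨C + D, fun z => ?_⟩
    have hderiv : ‖invPhi (deriv g) z‖ = ‖z‖ * ‖invPhi g z‖ := by simp [invPhi_deriv hg hgc]
    calc (1 + ‖z‖) ^ (n + 1) * ‖invPhi g z‖
        = (1 + ‖z‖) ^ n * ‖invPhi g z‖ + (1 + ‖z‖) ^ n * ‖invPhi (deriv g) z‖ := by
          rw [hderiv]; ring
      _ ≤ (C + D) * Real.exp (r * |z.im|) := by
          rw [add_mul]
          exact add_le_add (hC z) (hD z)

lemma exists_hasTypeBound_invPhi {g : ℝ → ℂ} (hg : ContDiff ℝ ∞ g) (hgc : HasCompactSupport g) :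
    ∃ r > 0, HasTypeBound (invPhi g) r := by
  obtain ⟨r, hr⟩ := hgc.isCompact.isBounded.exists_norm_le
  refine ⟨max r 1, lt_max_of_lt_right one_pos, differentiable_invPhi hg.continuous hgc,
    fun n => ?_⟩
  obtain ⟨C, hC⟩ := exists_pow_mul_norm_invPhi_le hg hgc
    (fun ξ hξ => (hr ξ hξ).trans (le_max_left r 1)) n
  refine ⟨C, fun z => ?_⟩
  rw [mul_right_comm, ← div_eq_mul_inv, le_div_iff₀ (by positivity), mul_comm]
  exact hC z

/-- The function `w ↦ √(2π) g(2πw)`, whose inverse Fourier transform in Mathlib's normalization is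
`invPhi g`. -/
noncomputable def rescale (g : ℝ → ℂ) (w : ℝ) : ℂ :=
  (√(2 * Real.pi) : ℂ) * g (2 * Real.pi * w)

lemma contDiff_rescale {g : ℝ → ℂ} (hg : ContDiff ℝ ∞ g) : ContDiff ℝ ∞ (rescale g) :=
  contDiff_const.mul (hg.comp (contDiff_const.mul contDiff_id))

lemma hasCompactSupport_rescale {g : ℝ → ℂ} (hgc : HasCompactSupport g) :
    HasCompactSupport (rescale g) :=
  (hgc.comp_homeomorph (Homeomorph.mulLeft₀ (2 * Real.pi) Real.two_pi_pos.ne')).mul_left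

lemma exists_rescale_eq {S : ℝ → ℂ} (hS : ContDiff ℝ ∞ S) (hSc : HasCompactSupport S) :
    ∃ g : ℝ → ℂ, ContDiff ℝ ∞ g ∧ HasCompactSupport g ∧ rescale g = S := by
  have hpi : (2 * Real.pi)⁻¹ ≠ 0 := by positivity
  refine ⟨fun ξ => (√(2 * Real.pi) : ℂ)⁻¹ * S ((2 * Real.pi)⁻¹ * ξ),
    contDiff_const.mul (hS.comp (contDiff_const.mul contDiff_id)),
    (hSc.comp_homeomorph (Homeomorph.mulLeft₀ _ hpi)).mul_left, ?_⟩
  ext w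
  rw [rescale, mul_inv_cancel_left₀ (by exact_mod_cast (by positivity : √(2 * Real.pi) ≠ 0)),
    inv_mul_cancel_left₀ (by positivity)]

lemma invPhi_eq_fourierInv (g : ℝ → ℂ) (x : ℝ) : invPhi g x = 𝓕⁻ (rescale g) x := by
  have hconst : (2 * Real.pi) ^ (-(1 / 2) : ℝ) = √(2 * Real.pi) * (2 * Real.pi)⁻¹ := by
    rw [Real.sqrt_eq_rpow, ← Real.rpow_neg_one, ← Real.rpow_add (by positivity)]
    norm_num
  have hscale := Measure.integral_comp_mul_left
    (fun ξ : ℝ => g ξ * Complex.exp (Complex.I * x * ξ)) (2 * Real.pi)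
  rw [abs_of_pos (inv_pos.2 Real.two_pi_pos), Complex.real_smul] at hscale
  rw [Real.fourierInv_eq', invPhi, hconst, Complex.ofReal_mul, mul_assoc, ← hscale,
    ← integral_const_mul]
  congr 1
  ext w
  simp only [rescale, smul_eq_mul, RCLike.inner_apply, conj_trivial]
  push_cast
  rw [show Complex.I * (x : ℂ) * (2 * Real.pi * w) = 2 * Real.pi * (x * w) * Complex.I by ring]
  ring

/-- The inverse Fourier transform `Φ* g` of a test function, as an element of `𝒵`. -/
noncomputable def invPhiZ (g : ℝ → ℂ) (hg : ContDiff ℝ ∞ g) (hgc : HasCompactSupport g) : ZSpace :=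
  ⟨𝓕⁻ ((hasCompactSupport_rescale hgc).toSchwartzMap (contDiff_rescale hg)), invPhi g,
    fun x => by
      rw [invPhi_eq_fourierInv, SchwartzMap.fourierInv_coe]
      rfl, exists_hasTypeBound_invPhi hg hgc⟩

lemma invPhiZ_apply {g : ℝ → ℂ} (hg : ContDiff ℝ ∞ g) (hgc : HasCompactSupport g) (x : ℝ) :
    (invPhiZ g hg hgc : 𝓢(ℝ, ℂ)) x = invPhi g x := by
  rw [invPhi_eq_fourierInv, invPhiZ, SchwartzMap.fourierInv_coe]
  rfl

lemma fourierPhi_invPhiZ {g : ℝ → ℂ} (hg : ContDiff ℝ ∞ g) (hgc : HasCompactSupport g) (ξ : ℝ) :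
    fourierPhi (invPhiZ g hg hgc : 𝓢(ℝ, ℂ)) ξ = g ξ := by
  set S := (hasCompactSupport_rescale hgc).toSchwartzMap (contDiff_rescale hg)
  have hinv : (𝓕 (𝓕⁻ S)) (ξ / (2 * Real.pi)) = (√(2 * Real.pi) : ℂ) * g ξ := by
    rw [FourierTransform.fourier_fourierInv_eq S]
    change rescale g _ = _
    rw [rescale, mul_div_cancel₀ _ Real.two_pi_pos.ne']
  rw [SchwartzMap.fourier_coe, Real.fourier_real_eq_integral_exp_smul] at hinv
  have hint : ∫ x : ℝ, (invPhiZ g hg hgc : 𝓢(ℝ, ℂ)) x * Complex.exp (-(Complex.I * x * ξ)) =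
      (√(2 * Real.pi) : ℂ) * g ξ := by
    rw [← hinv]
    congr 1
    ext x
    rw [smul_eq_mul, mul_comm]
    congr 2
    have : (Real.pi : ℂ) ≠ 0 := by exact_mod_cast Real.pi_ne_zero
    push_cast
    field_simp
  rw [fourierPhi, hint, ← mul_assoc, ← Complex.ofReal_mul, rpow_neg_half_mul_sqrt_two_pi,
    Complex.ofReal_one, one_mul]

lemma memLp_invPhi {g : ℝ → ℂ} (hg : ContDiff ℝ ∞ g) (hgc : HasCompactSupport g) :
    MemLp (fun x : ℝ => invPhi g x) 2 := by
  simpa only [← invPhiZ_apply hg hgc] using (invPhiZ g hg hgc : 𝓢(ℝ, ℂ)).memLp 2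

lemma continuous_invPhi {g : ℝ → ℂ} (hg : Continuous g) (hgc : HasCompactSupport g) :
    Continuous fun x : ℝ => invPhi g x :=
  (differentiable_invPhi hg hgc).continuous.comp Complex.continuous_ofReal

lemma eq_zero_of_forall_inner_invPhi {κ : Lp ℂ 2 (volume : Measure ℝ)}
    (h : ∀ g : ℝ → ℂ, ContDiff ℝ ∞ g → HasCompactSupport g →
      ∫ x, conj (κ x) * invPhi g x = 0) : κ = 0 := by
  suffices h𝓕 : 𝓕 κ = 0 by rw [← norm_eq_zero, ← Lp.norm_fourier_eq, h𝓕, norm_zero]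
  refine Dense.eq_zero_of_inner_left ℂ
    (Lp.dense_hasCompactSupport_contDiff (μ := (volume : Measure ℝ)) (F := ℂ) (p := 2)
      (by norm_num)) ?_
  rintro v ⟨S, hvS, hSc, hS⟩
  obtain ⟨g, hg, hgc, rfl⟩ := exists_rescale_eq hS hSc
  have hv : v = (hSc.toSchwartzMap hS).toLp 2 :=
    Lp.ext (hvS.trans ((hSc.toSchwartzMap hS).coeFn_toLp 2 volume).symm)
  rw [← FourierTransform.fourier_fourierInv_eq (F := Lp ℂ 2 (volume : Measure ℝ)) v,
    Lp.inner_fourier_eq, hv, SchwartzMap.toLp_fourierInv_eq, L2.inner_def, ← h g hg hgc]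
  refine integral_congr_ae ?_
  filter_upwards [(𝓕⁻ (hSc.toSchwartzMap hS)).coeFn_toLp 2 volume] with x hx
  rw [hx, RCLike.inner_apply', ← invPhiZ_apply hg hgc]
  rfl

/-! ### The change of variables `t = e^x` -/

lemma lintegral_Ioi_zero_eq_lintegral_exp (F : ℝ → ENNReal) :
    ∫⁻ t in Set.Ioi (0 : ℝ), F t = ∫⁻ x : ℝ, ENNReal.ofReal (Real.exp x) * F (Real.exp x) := by
  rw [← Real.range_exp, ← Set.image_univ, lintegral_image_eq_lintegral_abs_deriv_mul
    MeasurableSet.univ (fun x _ => (Real.hasDerivAt_exp x).hasDerivWithinAt)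
    Real.exp_injective.injOn]
  simp

lemma integral_Ioi_zero_eq_integral_exp {E : Type*} [NormedAddCommGroup E] [NormedSpace ℝ E]
    (F : ℝ → E) : ∫ t in Set.Ioi (0 : ℝ), F t = ∫ x : ℝ, Real.exp x • F (Real.exp x) := by
  rw [← Real.range_exp, ← Set.image_univ, integral_image_eq_integral_abs_deriv_smul
    MeasurableSet.univ (fun x _ => (Real.hasDerivAt_exp x).hasDerivWithinAt)
    Real.exp_injective.injOn]
  simp

lemma Uinv_exp (φ : ℝ → ℂ) (x : ℝ) : Uinv φ (Real.exp x) = (Real.exp (-(x / 2)) : ℂ) * φ x := by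
  rw [Uinv, Real.log_exp, ← Real.exp_mul]
  push_cast
  congr 2
  ring

lemma Uinv_exp_half_mul (f : ℝ → ℂ) {t : ℝ} (ht : 0 < t) :
    Uinv (fun x => (Real.exp (x / 2) : ℂ) * f (Real.exp x)) t = f t := by
  rw [← Real.exp_log ht, Uinv_exp, ← mul_assoc, ← Complex.ofReal_mul, ← Real.exp_add,
    neg_add_cancel, Real.exp_zero, Complex.ofReal_one, one_mul]

lemma eLpNorm_Uinv (φ : ℝ → ℂ) :
    eLpNorm (Uinv φ) 2 (volume.restrict (Set.Ioi (0 : ℝ))) = eLpNorm φ 2 volume := by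
  rw [← (ENNReal.pow_right_strictMono two_ne_zero).injective.eq_iff, eLpNorm_two_sq, eLpNorm_two_sq,
    lintegral_Ioi_zero_eq_lintegral_exp]
  refine lintegral_congr fun x => ?_
  have hweight : ENNReal.ofReal (Real.exp x) * ‖(Real.exp (-(x / 2)) : ℂ)‖ₑ ^ 2 = 1 := by
    rw [← ofReal_norm, Complex.norm_real, Real.norm_of_nonneg (Real.exp_pos _).le,
      ← ENNReal.ofReal_pow (Real.exp_pos _).le, ← ENNReal.ofReal_mul (Real.exp_pos _).le,
      ← Real.exp_nat_mul, ← Real.exp_add, show x + (2 : ℕ) * -(x / 2) = 0 by push_cast; ring,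
      Real.exp_zero, ENNReal.ofReal_one]
  rw [Uinv_exp, enorm_mul, mul_pow, ← mul_assoc, hweight, one_mul]

lemma integral_conj_Uinv_mul_Uinv (φ ψ : ℝ → ℂ) :
    ∫ t in Set.Ioi (0 : ℝ), conj (Uinv φ t) * Uinv ψ t = ∫ x, conj (φ x) * ψ x := by
  rw [integral_Ioi_zero_eq_integral_exp]
  refine integral_congr_ae (ae_of_all _ fun x => ?_)
  have hweight : (Real.exp x : ℂ) * (Real.exp (-(x / 2)) * Real.exp (-(x / 2))) = 1 := by
    rw [← Complex.ofReal_mul, ← Complex.ofReal_mul, ← Real.exp_add, ← Real.exp_add,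
      show x + (-(x / 2) + -(x / 2)) = 0 by ring, Real.exp_zero, Complex.ofReal_one]
  simp only [Uinv_exp, map_mul, Complex.conj_ofReal, Complex.real_smul]
  linear_combination conj (φ x) * ψ x * hweight

lemma measurable_Uinv {φ : ℝ → ℂ} (hφ : Measurable φ) : Measurable (Uinv φ) := by
  unfold Uinv
  fun_prop

/-! ### Density of the test functions -/

/-- The function `f` on `ℝ₊` for which `x ↦ e^{x/2} f(e^x)` is the inverse Fourier transform of the
test function `g`. -/
noncomputable def testFun (g : ℝ → ℂ) : ℝ → ℂ := Uinv fun x => invPhi g x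

lemma memLp_testFun {g : ℝ → ℂ} (hg : ContDiff ℝ ∞ g) (hgc : HasCompactSupport g) :
    MemLp (testFun g) 2 (volume.restrict (Set.Ioi (0 : ℝ))) :=
  ⟨(measurable_Uinv (continuous_invPhi hg.continuous hgc).measurable).aestronglyMeasurable,
    (eLpNorm_Uinv _).trans_lt (memLp_invPhi hg hgc).2⟩

/-- The subspace of `L²(ℝ₊)` of the functions `testFun g`, `g` a test function. -/
noncomputable def testSpace : Submodule ℂ L2Plus where
  carrier := {f | ∃ g : ℝ → ℂ, ContDiff ℝ ∞ g ∧ HasCompactSupport g ∧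
    f =ᵐ[volume.restrict (Set.Ioi (0 : ℝ))] testFun g}
  zero_mem' := by
    refine ⟨0, contDiff_const, HasCompactSupport.zero, ?_⟩
    filter_upwards [Lp.coeFn_zero ℂ 2 (volume.restrict (Set.Ioi (0 : ℝ)))] with t ht
    rw [ht]
    simp [testFun, Uinv, invPhi]
  add_mem' := by
    rintro f₁ f₂ ⟨g₁, hg₁, hc₁, hf₁⟩ ⟨g₂, hg₂, hc₂, hf₂⟩
    refine ⟨g₁ + g₂, hg₁.add hg₂, hc₁.add hc₂, ?_⟩
    filter_upwards [Lp.coeFn_add f₁ f₂, hf₁, hf₂] with t hadd ht₁ ht₂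
    rw [hadd, Pi.add_apply, ht₁, ht₂]
    simp only [testFun, Uinv, invPhi, ← mul_add, Pi.add_apply, add_mul]
    rw [integral_add (integrable_mul_of_hasCompactSupport hg₁.continuous hc₁ (by fun_prop))
      (integrable_mul_of_hasCompactSupport hg₂.continuous hc₂ (by fun_prop))]
  smul_mem' := by
    rintro c f ⟨g, hg, hc, hf⟩
    refine ⟨fun ξ => c * g ξ, contDiff_const.mul hg, hc.mul_left, ?_⟩
    filter_upwards [Lp.coeFn_smul c f, hf] with t hsmul ht
    rw [hsmul, Pi.smul_apply, ht]
    simp only [testFun, Uinv, invPhi, mul_assoc, integral_const_mul, smul_eq_mul]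
    ring

lemma eq_zero_of_forall_inner_testFun {h : L2Plus}
    (hh : ∀ g : ℝ → ℂ, ContDiff ℝ ∞ g → HasCompactSupport g →
      ∫ t in Set.Ioi (0 : ℝ), conj (h t) * testFun g t = 0) : h = 0 := by
  let κ : ℝ → ℂ := fun x => (Real.exp (x / 2) : ℂ) * h (Real.exp x)
  have hκh : Uinv κ =ᵐ[volume.restrict (Set.Ioi (0 : ℝ))] h := by
    filter_upwards [ae_restrict_mem measurableSet_Ioi] with t ht using Uinv_exp_half_mul h ht
  have hnorm : eLpNorm κ 2 volume = eLpNorm h 2 (volume.restrict (Set.Ioi (0 : ℝ))) := by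
    rw [← eLpNorm_Uinv, eLpNorm_congr_ae hκh]
  have hκm : StronglyMeasurable κ :=
    (by fun_prop : Continuous fun x : ℝ => (Real.exp (x / 2) : ℂ)).stronglyMeasurable.mul
      ((Lp.stronglyMeasurable h).comp_measurable Real.measurable_exp)
  have hκ : MemLp κ 2 volume := ⟨hκm.aestronglyMeasurable, hnorm.trans_lt (Lp.memLp h).2⟩
  have hκ₀ : hκ.toLp κ = 0 := by
    refine eq_zero_of_forall_inner_invPhi fun g hg hgc => ?_
    calc ∫ x, conj (hκ.toLp κ x) * invPhi g x = ∫ x, conj (κ x) * invPhi g x := by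
          refine integral_congr_ae ?_
          filter_upwards [hκ.coeFn_toLp] with x hx
          rw [hx]
      _ = ∫ t in Set.Ioi (0 : ℝ), conj (Uinv κ t) * testFun g t :=
          (integral_conj_Uinv_mul_Uinv κ fun x => invPhi g x).symm
      _ = ∫ t in Set.Ioi (0 : ℝ), conj (h t) * testFun g t := by
          refine integral_congr_ae ?_
          filter_upwards [hκh] with t ht
          rw [ht]
      _ = 0 := hh g hg hgc
  rw [← norm_eq_zero, Lp.norm_def, ← hnorm, ← Lp.norm_toLp κ hκ, hκ₀, norm_zero]

lemma dense_testSpace : Dense (testSpace : Set L2Plus) := by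
  rw [Submodule.dense_iff_topologicalClosure_eq_top, Submodule.topologicalClosure_eq_top_iff,
    Submodule.eq_bot_iff]
  intro h hh
  refine eq_zero_of_forall_inner_testFun fun g hg hgc => ?_
  have hmem : (memLp_testFun hg hgc).toLp _ ∈ testSpace := ⟨g, hg, hgc, MemLp.coeFn_toLp _⟩
  have horth := Submodule.inner_left_of_mem_orthogonal hmem hh
  rw [L2.inner_def] at horth
  rw [← horth]
  refine integral_congr_ae ?_
  filter_upwards [(memLp_testFun hg hgc).coeFn_toLp] with t ht
  rw [ht, RCLike.inner_apply']

end TestFunctions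

/-! ### Gamma factors -/

lemma contDiff_inv_Gamma_line (a : ℂ) :
    ContDiff ℝ ∞ fun ξ : ℝ => (Complex.Gamma (a + Complex.I * ξ))⁻¹ :=
  ((Complex.differentiable_one_div_Gamma.contDiff (n := ∞)).restrict_scalars ℝ).comp
    (contDiff_const.add (contDiff_const.mul Complex.ofRealCLM.contDiff))

lemma Gamma_line_ne_zero {a : ℂ} (ha : 0 < a.re) (ξ : ℝ) :
    Complex.Gamma (a + Complex.I * ξ) ≠ 0 :=
  Complex.Gamma_ne_zero_of_re_pos (by simpa using ha)

lemma contDiff_Gamma_line {a : ℂ} (ha : 0 < a.re) :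
    ContDiff ℝ ∞ fun ξ : ℝ => Complex.Gamma (a + Complex.I * ξ) := by
  simpa only [Pi.inv_def, inv_inv] using
    (contDiff_inv_Gamma_line a).inv fun ξ => inv_ne_zero (Gamma_line_ne_zero ha ξ)

/-- The function `Γ(1/2 + iξ) g(ξ)`, to which the Laplace transform takes the test function `g`, up
to the reflection `ξ ↦ -ξ`. -/
noncomputable def gammaMul (g : ℝ → ℂ) (ξ : ℝ) : ℂ :=
  Complex.Gamma (1 / 2 + Complex.I * ξ) * g ξ

lemma contDiff_gammaMul {g : ℝ → ℂ} (hg : ContDiff ℝ ∞ g) : ContDiff ℝ ∞ (gammaMul g) :=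
  (contDiff_Gamma_line (by norm_num)).mul hg

lemma hasCompactSupport_gammaMul {g : ℝ → ℂ} (hg : HasCompactSupport g) :
    HasCompactSupport (gammaMul g) := hg.mul_left

lemma exists_gammaMul_eq {h : ℝ → ℂ} (hh : ContDiff ℝ ∞ h) (hhc : HasCompactSupport h) :
    ∃ g, ContDiff ℝ ∞ g ∧ HasCompactSupport g ∧ gammaMul g = h := by
  refine ⟨fun ξ => (Complex.Gamma (1 / 2 + Complex.I * ξ))⁻¹ * h ξ,
    (contDiff_inv_Gamma_line _).mul hh, hhc.mul_left, ?_⟩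
  ext ξ
  rw [gammaMul, mul_inv_cancel_left₀ (Gamma_line_ne_zero (by norm_num) ξ)]

/-! ### The Laplace transform of test functions -/

lemma cpow_add_I_mul {s : ℝ} (hs : 0 < s) (r ξ : ℝ) :
    (s : ℂ) ^ ((r : ℂ) + Complex.I * ξ) =
      ((s ^ r : ℝ) : ℂ) * Complex.exp (Complex.I * Real.log s * ξ) := by
  have hs' : (s : ℂ) ≠ 0 := by exact_mod_cast hs.ne'
  rw [Complex.cpow_add _ _ hs', Complex.ofReal_cpow hs.le,
    Complex.cpow_def_of_ne_zero hs' (Complex.I * ξ), Complex.ofReal_log hs.le]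
  congr 2
  ring

lemma testFun_eq_integral_cpow (g : ℝ → ℂ) {s : ℝ} (hs : 0 < s) :
    testFun g s = (((2 * Real.pi) ^ (-(1 / 2) : ℝ) : ℝ) : ℂ) *
      ∫ ξ : ℝ, g ξ * (s : ℂ) ^ ((-(1 / 2) : ℝ) + Complex.I * ξ) := by
  simp only [testFun, Uinv, invPhi, cpow_add_I_mul hs]
  rw [mul_left_comm, ← integral_const_mul]
  simp only [mul_left_comm]

lemma norm_cpow_add_I_mul {s : ℝ} (hs : 0 < s) (r ξ : ℝ) :
    ‖(s : ℂ) ^ ((r : ℂ) + Complex.I * ξ)‖ = s ^ r := by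
  simp [Complex.norm_cpow_eq_rpow_re_of_pos hs]

lemma integrable_exp_mul_cpow {g : ℝ → ℂ} (hg : Continuous g) (hgc : HasCompactSupport g)
    {t : ℝ} (ht : 0 < t) :
    Integrable (Function.uncurry fun s ξ : ℝ => Complex.exp (-(t * s : ℝ)) *
      (g ξ * (s : ℂ) ^ ((-(1 / 2) : ℝ) + Complex.I * ξ)))
      ((volume.restrict (Set.Ioi (0 : ℝ))).prod volume) := by
  have hdom := ((integrableOn_rpow_neg_half_mul_exp_neg_mul ht).ofReal (𝕜 := ℂ)).mul_prod
    (hg.integrable_of_hasCompactSupport (μ := volume) hgc)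
  refine hdom.mono ?_ ?_
  · have := hg.measurable
    refine Measurable.aestronglyMeasurable ?_
    unfold Function.uncurry
    fun_prop
  · filter_upwards [Measure.quasiMeasurePreserving_fst.ae
      (ae_restrict_mem (measurableSet_Ioi (a := (0 : ℝ))))] with p hp
    have hs : 0 < p.1 := hp
    simp only [Function.uncurry, norm_mul, norm_cpow_add_I_mul hs, Complex.norm_exp,
      Complex.neg_re, Complex.ofReal_re, RCLike.norm_ofReal, abs_mul,
      abs_of_pos (Real.rpow_pos_of_pos hs _), Real.abs_exp]
    exact (by ring : _ = _).le

lemma integral_exp_mul_cpow {t : ℝ} (ht : 0 < t) (ξ : ℝ) :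
    ∫ s in Set.Ioi (0 : ℝ), Complex.exp (-(t * s : ℝ)) *
        (s : ℂ) ^ ((-(1 / 2) : ℝ) + Complex.I * ξ) =
      Complex.Gamma (1 / 2 + Complex.I * ξ) *
        (((t ^ (-(1 / 2) : ℝ) : ℝ) : ℂ) *
          Complex.exp (Complex.I * ((-Real.log t : ℝ) : ℂ) * ξ)) := by
  have hgamma := Complex.integral_cpow_mul_exp_neg_mul_Ioi
    (a := 1 / 2 + Complex.I * ξ) (r := t) (by simp) ht
  have hpow : (1 / (t : ℂ)) ^ (1 / 2 + Complex.I * ξ) =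
      ((t ^ (-(1 / 2) : ℝ) : ℝ) : ℂ) *
        Complex.exp (Complex.I * ((-Real.log t : ℝ) : ℂ) * ξ) := by
    have h := cpow_add_I_mul (inv_pos.2 ht) (1 / 2) ξ
    rw [Real.log_inv, Real.inv_rpow ht.le, ← Real.rpow_neg ht.le] at h
    rw [← h]
    push_cast
    rw [one_div]
  rw [← hpow, mul_comm (Complex.Gamma _), ← hgamma]
  refine integral_congr_ae (ae_of_all _ fun s => ?_)
  have hexponent : 1 / 2 + Complex.I * ξ - 1 = ((-(1 / 2) : ℝ) : ℂ) + Complex.I * ξ := by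
    push_cast; ring
  simp only [hexponent, Complex.ofReal_mul, mul_comm]

lemma laplaceFun_testFun {g : ℝ → ℂ} (hg : Continuous g) (hgc : HasCompactSupport g)
    {t : ℝ} (ht : 0 < t) :
    laplaceFun (testFun g) t = Uinv (fun x => invPhi (gammaMul g) ((-x : ℝ) : ℂ)) t := by
  calc laplaceFun (testFun g) t
      = (((2 * Real.pi) ^ (-(1 / 2) : ℝ) : ℝ) : ℂ) * ∫ s in Set.Ioi (0 : ℝ), ∫ ξ : ℝ,
          Complex.exp (-(t * s : ℝ)) *
            (g ξ * (s : ℂ) ^ ((-(1 / 2) : ℝ) + Complex.I * ξ)) := by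
        rw [laplaceFun, ← integral_const_mul]
        refine setIntegral_congr_fun measurableSet_Ioi fun s hs => ?_
        simp only [testFun_eq_integral_cpow g hs, integral_const_mul]
        rw [mul_left_comm]
    _ = (((2 * Real.pi) ^ (-(1 / 2) : ℝ) : ℝ) : ℂ) * ∫ ξ : ℝ, ∫ s in Set.Ioi (0 : ℝ),
          Complex.exp (-(t * s : ℝ)) *
            (g ξ * (s : ℂ) ^ ((-(1 / 2) : ℝ) + Complex.I * ξ)) := by
        rw [integral_integral_swap (integrable_exp_mul_cpow hg hgc ht)]
    _ = (((2 * Real.pi) ^ (-(1 / 2) : ℝ) : ℝ) : ℂ) * ∫ ξ : ℝ, ((t ^ (-(1 / 2) : ℝ) : ℝ) : ℂ) *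
          (gammaMul g ξ * Complex.exp (Complex.I * ((-Real.log t : ℝ) : ℂ) * ξ)) := by
        congr 2
        ext ξ
        simp only [mul_left_comm _ (g ξ)]
        rw [integral_const_mul, integral_exp_mul_cpow ht, gammaMul]
        ring
    _ = Uinv (fun x => invPhi (gammaMul g) ((-x : ℝ) : ℂ)) t := by
        rw [integral_const_mul, mul_left_comm, Uinv, invPhi]

lemma laplace_ae_eq_of_ae_eq_testFun {g : ℝ → ℂ} (hg : Continuous g) (hgc : HasCompactSupport g)
    {f : L2Plus} (hf : f =ᵐ[volume.restrict (Set.Ioi (0 : ℝ))] testFun g) :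
    laplace f =ᵐ[volume.restrict (Set.Ioi (0 : ℝ))]
      Uinv fun x => invPhi (gammaMul g) ((-x : ℝ) : ℂ) := by
  filter_upwards [coeFn_laplace f, ae_restrict_mem measurableSet_Ioi] with t hlaplace ht
  rw [hlaplace, ← laplaceFun_testFun hg hgc ht]
  refine integral_congr_ae ?_
  filter_upwards [hf] with s hs
  rw [hs]

lemma invPhi_comp_neg (g : ℝ → ℂ) (z : ℂ) : invPhi (fun ξ => g (-ξ)) z = invPhi g (-z) := by
  rw [invPhi, invPhi, ← integral_neg_eq_self]
  simp

/-- The Laplace transform is self-adjoint, and its range contains all test functions because the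
Gamma factor has no zeros. -/
lemma laplace_injective : Function.Injective laplace := by
  rw [injective_iff_map_eq_zero]
  intro h hh
  refine eq_zero_of_forall_inner_testFun fun g hg hgc => ?_
  obtain ⟨q, hq, hqc, hqg⟩ := exists_gammaMul_eq (h := fun ξ => g (-ξ)) (hg.comp contDiff_neg)
    (hgc.comp_homeomorph (Homeomorph.neg ℝ))
  let f : L2Plus := (memLp_testFun hq hqc).toLp _
  have horth : ⟪h, laplace f⟫_ℂ = 0 := by
    rw [← isSelfAdjoint_laplace.isSymmetric.apply_clm, hh, inner_zero_left]
  rw [L2.inner_def] at horth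
  rw [← horth]
  refine integral_congr_ae ?_
  filter_upwards [laplace_ae_eq_of_ae_eq_testFun hq.continuous hqc (f := f) (MemLp.coeFn_toLp _)]
    with t ht
  rw [ht, RCLike.inner_apply', hqg]
  simp only [testFun, invPhi_comp_neg, Complex.ofReal_neg, neg_neg]

lemma norm_laplace_sq_of_ae_eq_testFun {g : ℝ → ℂ} (hg : Continuous g) (hgc : HasCompactSupport g)
    {f : L2Plus} (hf : f =ᵐ[volume.restrict (Set.Ioi (0 : ℝ))] testFun g) :
    ‖laplace f‖ ^ 2 = ∫ x : ℝ, ‖invPhi (gammaMul g) x‖ ^ 2 := by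
  have hinner : ⟪laplace f, laplace f⟫_ℂ =
      ((∫ x : ℝ, ‖invPhi (gammaMul g) x‖ ^ 2 : ℝ) : ℂ) := by
    calc ⟪laplace f, laplace f⟫_ℂ
        = ∫ t in Set.Ioi (0 : ℝ), conj (Uinv (fun x => invPhi (gammaMul g) ((-x : ℝ) : ℂ)) t) *
            Uinv (fun x => invPhi (gammaMul g) ((-x : ℝ) : ℂ)) t := by
          rw [L2.inner_def]
          refine integral_congr_ae ?_
          filter_upwards [laplace_ae_eq_of_ae_eq_testFun hg hgc hf] with t ht
          rw [ht, RCLike.inner_apply']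
      _ = ∫ x : ℝ, conj (invPhi (gammaMul g) x) * invPhi (gammaMul g) x := by
          rw [integral_conj_Uinv_mul_Uinv]
          exact integral_neg_eq_self
            (fun x : ℝ => conj (invPhi (gammaMul g) x) * invPhi (gammaMul g) x) volume
      _ = ((∫ x : ℝ, ‖invPhi (gammaMul g) x‖ ^ 2 : ℝ) : ℂ) := by
          rw [← integral_complex_ofReal]
          simp only [Complex.conj_mul', Complex.ofReal_pow]
  have hnorm : ((‖laplace f‖ ^ 2 : ℝ) : ℂ) = ⟪laplace f, laplace f⟫_ℂ := by
    rw [inner_self_eq_norm_sq_to_K]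
    norm_cast
  exact_mod_cast hnorm.trans hinner

/-! ### Autocorrelations and the Laplace convolution of test functions -/

/-- The autocorrelation `ξ ↦ (2π)^{-1/2} ∫ conj(γ(η)) γ(η + ξ) dη`, whose inverse Fourier transform
is `|Φ* γ|²`. -/
noncomputable def autocorr (γ : ℝ → ℂ) (ξ : ℝ) : ℂ :=
  (((2 * Real.pi) ^ (-(1 / 2) : ℝ) : ℝ) : ℂ) * ∫ η : ℝ, conj (γ η) * γ (η + ξ)

lemma autocorr_eq_convolution (γ : ℝ → ℂ) :
    autocorr γ = fun ξ => (((2 * Real.pi) ^ (-(1 / 2) : ℝ) : ℝ) : ℂ) *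
      convolution (fun η => conj (γ (-η))) γ (ContinuousLinearMap.mul ℝ ℂ) volume ξ := by
  ext ξ
  rw [autocorr, convolution_def, ← integral_neg_eq_self]
  simp only [ContinuousLinearMap.mul_apply', neg_add_eq_sub]

lemma contDiff_autocorr {γ : ℝ → ℂ} (hγ : ContDiff ℝ ∞ γ) (hγc : HasCompactSupport γ) :
    ContDiff ℝ ∞ (autocorr γ) := by
  rw [autocorr_eq_convolution]
  have hconj : Continuous fun η => conj (γ (-η)) :=
    Complex.continuous_conj.comp (hγ.continuous.comp continuous_neg)
  exact contDiff_const.mul (hγc.contDiff_convolution_right _ hconj.locallyIntegrable hγ)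

lemma hasCompactSupport_autocorr {γ : ℝ → ℂ} (hγc : HasCompactSupport γ) :
    HasCompactSupport (autocorr γ) := by
  rw [autocorr_eq_convolution]
  refine HasCompactSupport.mul_left (HasCompactSupport.convolution _ ?_ hγc)
  exact (hγc.comp_homeomorph (Homeomorph.neg ℝ)).comp_left (g := conj) (map_zero _)

lemma hasCompactSupport_conj_mul {γ : ℝ → ℂ} (hγc : HasCompactSupport γ) :
    HasCompactSupport fun p : ℝ × ℝ => conj (γ p.1) * γ p.2 := by
  refine HasCompactSupport.intro (hγc.isCompact.prod hγc.isCompact) fun p hp => ?_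
  rw [Set.mem_prod, not_and_or] at hp
  rcases hp with hp | hp <;> simp [image_eq_zero_of_notMem_tsupport hp]

lemma integral_mul_autocorr {γ m : ℝ → ℂ} (hγ : Continuous γ) (hγc : HasCompactSupport γ)
    (hm : Continuous m) :
    ∫ ξ : ℝ, m ξ * autocorr γ ξ = (((2 * Real.pi) ^ (-(1 / 2) : ℝ) : ℝ) : ℂ) *
      ∫ p : ℝ × ℝ, conj (γ p.1) * γ p.2 * m (p.2 - p.1) := by
  have hint : Integrable fun p : ℝ × ℝ => conj (γ p.1) * γ p.2 * m (p.2 - p.1) :=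
    Continuous.integrable_of_hasCompactSupport (by fun_prop)
      (hasCompactSupport_conj_mul hγc).mul_right
  have hshear := measurePreserving_prod_add (volume : Measure ℝ) (volume : Measure ℝ)
  have hemb : MeasurableEmbedding fun p : ℝ × ℝ => (p.1, p.1 + p.2) :=
    (MeasurableEquiv.shearAddRight ℝ).measurableEmbedding
  have hint' : Integrable (fun p : ℝ × ℝ => conj (γ p.1) * γ (p.1 + p.2) * m (p.1 + p.2 - p.1))
      (volume.prod volume) := (hshear.integrable_comp_emb hemb).2 hint
  have hcomp := hshear.integral_comp hemb fun p => conj (γ p.1) * γ p.2 * m (p.2 - p.1)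
  simp only at hcomp
  rw [Measure.volume_eq_prod, ← hcomp, integral_prod_symm _ hint', ← integral_const_mul]
  refine integral_congr_ae (ae_of_all _ fun ξ => ?_)
  simp only [add_sub_cancel_left]
  rw [integral_mul_const, autocorr]
  ring

lemma conj_integral_mul_integral (u w : ℝ → ℂ) :
    conj (∫ ξ, u ξ) * ∫ ξ, w ξ = ∫ p : ℝ × ℝ, conj (u p.1) * w p.2 := by
  rw [← integral_conj, Measure.volume_eq_prod, ← integral_prod_mul]

lemma conj_invPhi_mul_invPhi {γ : ℝ → ℂ} (hγ : Continuous γ) (hγc : HasCompactSupport γ)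
    (x : ℝ) : conj (invPhi γ x) * invPhi γ x = invPhi (autocorr γ) x := by
  have hexp (p : ℝ × ℝ) : Complex.exp (Complex.I * x * ((p.2 - p.1 : ℝ) : ℂ)) =
      conj (Complex.exp (Complex.I * x * p.1)) * Complex.exp (Complex.I * x * p.2) := by
    rw [← Complex.exp_conj, ← Complex.exp_add]
    simp only [map_mul, Complex.conj_I, Complex.conj_ofReal]
    push_cast
    ring_nf
  have hautocorr := integral_mul_autocorr hγ hγc
    (m := fun ξ : ℝ => Complex.exp (Complex.I * x * ξ)) (by fun_prop)
  have hprod := conj_integral_mul_integral (fun ξ => γ ξ * Complex.exp (Complex.I * x * ξ))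
    fun ξ => γ ξ * Complex.exp (Complex.I * x * ξ)
  simp only [hexp] at hautocorr
  simp only [map_mul, mul_mul_mul_comm _ _ (γ _)] at hprod
  simp only [invPhi, map_mul, Complex.conj_ofReal]
  rw [mul_mul_mul_comm, hprod, mul_assoc, ← hautocorr]
  simp only [mul_comm]

lemma integral_cpow_mul_cpow {T : ℝ} (hT : 0 < T) {u v : ℂ} (hu : 0 < u.re) (hv : 0 < v.re) :
    ∫ s in Set.Ioo 0 T, (s : ℂ) ^ (u - 1) * ((T - s : ℝ) : ℂ) ^ (v - 1) =
      (T : ℂ) ^ (u + v - 1) * ((Complex.Gamma (u + v))⁻¹ *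
        (Complex.Gamma u * Complex.Gamma v)) := by
  have huv : Complex.Gamma (u + v) ≠ 0 := Complex.Gamma_ne_zero_of_re_pos (add_pos hu hv)
  rw [Complex.Gamma_mul_Gamma_eq_betaIntegral hu hv, inv_mul_cancel_left₀ huv,
    ← Complex.betaIntegral_scaled u v hT, intervalIntegral.integral_of_le hT.le,
    integral_Ioc_eq_integral_Ioo]
  simp only [Complex.ofReal_sub]

lemma integrableOn_cpow_mul_cpow {T : ℝ} (hT : 0 < T) {u v : ℂ} (hu : 0 < u.re) (hv : 0 < v.re) :
    IntegrableOn (fun s : ℝ => (s : ℂ) ^ (u - 1) * ((T - s : ℝ) : ℂ) ^ (v - 1)) (Set.Ioo 0 T) := by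
  refine Integrable.of_integral_ne_zero ?_
  rw [integral_cpow_mul_cpow hT hu hv]
  have hT' : (T : ℂ) ≠ 0 := by exact_mod_cast hT.ne'
  exact mul_ne_zero (by simp [Complex.cpow_eq_zero_iff, hT']) <|
    mul_ne_zero (inv_ne_zero (Complex.Gamma_ne_zero_of_re_pos (add_pos hu hv))) <|
    mul_ne_zero (Complex.Gamma_ne_zero_of_re_pos hu) (Complex.Gamma_ne_zero_of_re_pos hv)

lemma conj_cpow_add_I_mul {s : ℝ} (hs : 0 < s) (r ξ : ℝ) :
    conj ((s : ℂ) ^ ((r : ℂ) + Complex.I * ξ)) = (s : ℂ) ^ ((r : ℂ) - Complex.I * ξ) := by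
  have harg : (s : ℂ).arg ≠ Real.pi := by
    rw [Complex.arg_ofReal_of_nonneg hs.le]
    exact Real.pi_ne_zero.symm
  rw [← Complex.conj_ofReal s, ← Complex.cpow_conj _ _ harg, Complex.conj_ofReal]
  simp [sub_eq_add_neg]

lemma conj_Gamma_add_I_mul (r ξ : ℝ) : conj (Complex.Gamma (r + Complex.I * ξ)) =
    Complex.Gamma (r - Complex.I * ξ) := by
  rw [← Complex.Gamma_conj]
  simp [sub_eq_add_neg]

lemma integral_conj_cpow_mul_cpow (x η ζ : ℝ) :
    ∫ s in Set.Ioo 0 (Real.exp x), conj ((s : ℂ) ^ ((-(1 / 2) : ℝ) + Complex.I * η)) *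
        ((Real.exp x - s : ℝ) : ℂ) ^ ((-(1 / 2) : ℝ) + Complex.I * ζ) =
      Complex.exp (Complex.I * x * ((ζ - η : ℝ) : ℂ)) *
        (Complex.Gamma (1 + Complex.I * ((ζ - η : ℝ) : ℂ)))⁻¹ *
          (conj (Complex.Gamma (1 / 2 + Complex.I * η)) *
            Complex.Gamma (1 / 2 + Complex.I * ζ)) := by
  have hbeta := integral_cpow_mul_cpow (Real.exp_pos x) (u := 1 / 2 - Complex.I * η)
    (v := 1 / 2 + Complex.I * ζ) (by simp) (by simp)
  have hpow := cpow_add_I_mul (Real.exp_pos x) 0 (ζ - η)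
  have hconj := conj_Gamma_add_I_mul (1 / 2) η
  have hadd : 1 / 2 - Complex.I * η + (1 / 2 + Complex.I * ζ) =
    1 + Complex.I * ((ζ - η : ℝ) : ℂ) := by push_cast; ring
  rw [Complex.ofReal_zero, zero_add, Real.rpow_zero, Complex.ofReal_one, one_mul,
    Real.log_exp] at hpow
  push_cast at hconj
  rw [hadd, add_sub_cancel_left, hpow, ← hconj, ← mul_assoc] at hbeta
  rw [← hbeta]
  refine setIntegral_congr_fun measurableSet_Ioo fun s hs => ?_
  simp only [conj_cpow_add_I_mul hs.1]
  congr 2 <;> push_cast <;> ring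

/-- The integrand of the Laplace convolution of two test functions, expanded by
`testFun_eq_integral_cpow`. -/
noncomputable def convKernel (g : ℝ → ℂ) (T s : ℝ) (p : ℝ × ℝ) : ℂ :=
  conj ((s : ℂ) ^ ((-(1 / 2) : ℝ) + Complex.I * p.1)) *
      ((T - s : ℝ) : ℂ) ^ ((-(1 / 2) : ℝ) + Complex.I * p.2) * (conj (g p.1) * g p.2)

lemma conj_testFun_mul_testFun (g : ℝ → ℂ) {s T : ℝ} (hs : s ∈ Set.Ioo 0 T) :
    conj (testFun g s) * testFun g (T - s) = (((2 * Real.pi) ^ (-(1 / 2) : ℝ) : ℝ) : ℂ) ^ 2 *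
      ∫ p, convKernel g T s p := by
  have hprod := conj_integral_mul_integral
    (fun ξ => g ξ * (s : ℂ) ^ ((-(1 / 2) : ℝ) + Complex.I * ξ))
    fun ξ => g ξ * ((T - s : ℝ) : ℂ) ^ ((-(1 / 2) : ℝ) + Complex.I * ξ)
  rw [testFun_eq_integral_cpow g hs.1, testFun_eq_integral_cpow g (sub_pos.2 hs.2), map_mul,
    Complex.conj_ofReal, mul_mul_mul_comm, hprod, sq]
  simp only [convKernel, map_mul, mul_mul_mul_comm (conj (g _))]
  simp only [mul_comm (conj (g _) * g _)]

lemma integrable_convKernel {g : ℝ → ℂ} (hg : Continuous g) (hgc : HasCompactSupport g) {T : ℝ}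
    (hT : 0 < T) : Integrable (Function.uncurry (convKernel g T))
      ((volume.restrict (Set.Ioo 0 T)).prod volume) := by
  have hprod : Integrable fun p : ℝ × ℝ => conj (g p.1) * g p.2 :=
    Continuous.integrable_of_hasCompactSupport (by fun_prop) (hasCompactSupport_conj_mul hgc)
  have hbeta := integrableOn_cpow_mul_cpow hT (u := 1 / 2) (v := 1 / 2) (by simp) (by simp)
  refine (hbeta.mul_prod hprod).mono ?_ ?_
  · have := hg.measurable
    have := (Complex.continuous_conj.comp hg).measurable
    refine Measurable.aestronglyMeasurable ?_
    unfold Function.uncurry convKernel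
    fun_prop
  · filter_upwards [Measure.quasiMeasurePreserving_fst.ae
      (ae_restrict_mem (measurableSet_Ioo (a := 0) (b := T)))] with q hq
    have hhalf : (1 / 2 - 1 : ℂ) = ((-(1 / 2) : ℝ) : ℂ) + Complex.I * (0 : ℝ) := by
      push_cast; ring
    have hnorm (s : ℝ) (hs : 0 < s) (ξ : ℝ) :
        ‖(s : ℂ) ^ ((-(1 / 2) : ℝ) + Complex.I * ξ)‖ = ‖(s : ℂ) ^ (1 / 2 - 1 : ℂ)‖ := by
      rw [hhalf, norm_cpow_add_I_mul hs, norm_cpow_add_I_mul hs]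
    simp only [Function.uncurry, convKernel, norm_mul, RCLike.norm_conj, hnorm _ hq.1,
      hnorm _ (sub_pos.2 hq.2), le_refl]

/-- The beta integral produces `Γ(1/2 - iη) Γ(1/2 + iζ) / Γ(1 + i(ζ - η))`; the factor
`Γ(1 + i(ζ - η))⁻¹` is the one by which the sign-function is defined. -/
lemma laplaceConv_testFun {g : ℝ → ℂ} (hg : ContDiff ℝ ∞ g) (hgc : HasCompactSupport g) (x : ℝ) :
    laplaceConv (testFun g) (testFun g) (Real.exp x) =
      invPhi (fun ξ => (Complex.Gamma (1 + Complex.I * ξ))⁻¹ * autocorr (gammaMul g) ξ) x := by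
  have hm : Continuous fun ξ : ℝ => Complex.exp (Complex.I * x * ξ) *
      (Complex.Gamma (1 + Complex.I * ξ))⁻¹ :=
    (by fun_prop : Continuous fun ξ : ℝ => Complex.exp (Complex.I * x * ξ)).mul
      (contDiff_inv_Gamma_line 1).continuous
  have hinner (p : ℝ × ℝ) : ∫ s in Set.Ioo 0 (Real.exp x), convKernel g (Real.exp x) s p =
      conj (gammaMul g p.1) * gammaMul g p.2 *
        (Complex.exp (Complex.I * x * ((p.2 - p.1 : ℝ) : ℂ)) *
          (Complex.Gamma (1 + Complex.I * ((p.2 - p.1 : ℝ) : ℂ)))⁻¹) := by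
    simp only [convKernel]
    rw [integral_mul_const, integral_conj_cpow_mul_cpow, gammaMul, gammaMul, map_mul]
    ring
  rw [laplaceConv, intervalIntegral.integral_of_le (Real.exp_pos x).le,
    integral_Ioc_eq_integral_Ioo, setIntegral_congr_fun measurableSet_Ioo
      fun s hs => conj_testFun_mul_testFun g hs, integral_const_mul,
    integral_integral_swap (integrable_convKernel hg.continuous hgc (Real.exp_pos x)),
    integral_congr_ae (ae_of_all _ hinner), sq, mul_assoc,
    ← integral_mul_autocorr (contDiff_gammaMul hg).continuous (hasCompactSupport_gammaMul hgc) hm,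
    invPhi]
  simp only [mul_comm, mul_left_comm]

/-! ### Hankel operators with a bounded non-negative sign-function -/

lemma isSelfAdjoint_of_im_inner_eq_zero {E : Type*} [NormedAddCommGroup E]
    [InnerProductSpace ℂ E] [CompleteSpace E] {A : E →L[ℂ] E}
    (h : ∀ f : E, (⟪f, A f⟫_ℂ).im = 0) : IsSelfAdjoint A := by
  rw [ContinuousLinearMap.isSelfAdjoint_iff_isSymmetric,
    LinearMap.isSymmetric_iff_inner_map_self_real]
  intro f
  rw [inner_conj_symm, ContinuousLinearMap.coe_coe, ← inner_conj_symm (A f) f]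
  exact (Complex.conj_eq_iff_im.2 (h f)).symm

/-- A smooth compactly supported function as an element of `C₀^∞(ℝ)`. -/
def toCcInfty (g : ℝ → ℂ) (hg : ContDiff ℝ ∞ g) (hgc : HasCompactSupport g) : CcInfty :=
  ⟨g, hg, hgc, Set.subset_univ _⟩

variable {H : L2Plus →L[ℂ] L2Plus} {θ s : ZDual}

lemma apply_invPhiZ_inv_Gamma_mul (hs : IsSignFunctionOf θ s) {h : ℝ → ℂ}
    (hh : ContDiff ℝ ∞ h) (hhc : HasCompactSupport h) :
    θ.toFun (invPhiZ (fun ξ => (Complex.Gamma (1 + Complex.I * ξ))⁻¹ * h ξ)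
      ((contDiff_inv_Gamma_line 1).mul hh) hhc.mul_left) = s.toFun (invPhiZ h hh hhc) := by
  obtain ⟨a, b, hθa, hab, hbs⟩ := hs
  have hmul : ContDiff ℝ ∞ fun ξ : ℝ => (Complex.Gamma (1 + Complex.I * ξ))⁻¹ * h ξ :=
    (contDiff_inv_Gamma_line 1).mul hh
  have hmulc : HasCompactSupport fun ξ : ℝ => (Complex.Gamma (1 + Complex.I * ξ))⁻¹ * h ξ :=
    hhc.mul_left
  have hθ := hθa (invPhiZ _ hmul hmulc) (toCcInfty _ hmul hmulc) fun ξ =>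
    (fourierPhi_invPhiZ hmul hmulc ξ).symm
  have hs := hbs (invPhiZ h hh hhc) (toCcInfty h hh hhc) fun ξ => (fourierPhi_invPhiZ hh hhc ξ).symm
  have hb := hab (toCcInfty h hh hhc) (toCcInfty _ hmul hmulc) fun ξ => by
    have hconj := conj_Gamma_add_I_mul 1 (-ξ)
    simp only [Complex.ofReal_one, Complex.ofReal_neg, mul_neg, sub_neg_eq_add,
      ← sub_eq_add_neg] at hconj
    rw [map_inv₀, hconj]
    rfl
  have hconst : (Real.sqrt (2 * Real.pi) : ℂ) * (((2 * Real.pi) ^ (-(1 / 2) : ℝ) : ℝ) : ℂ) = 1 := by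
    rw [mul_comm]
    exact_mod_cast rpow_neg_half_mul_sqrt_two_pi
  rw [← hθ, ← hs]
  change _ = (Real.sqrt (2 * Real.pi) : ℂ) * b (toCcInfty h hh hhc)
  rw [hb, ← mul_assoc, hconst, one_mul]

lemma inner_apply_of_ae_eq_testFun (hH : IsHankelOperator H θ) (hs : IsSignFunctionOf θ s)
    {s₀ : ℝ → ℝ}
    (hs₀ : ∀ u : ZSpace, s.toFun u = ∫ x : ℝ, (s₀ x : ℂ) * conj ((u : 𝓢(ℝ, ℂ)) x))
    {g : ℝ → ℂ} (hg : ContDiff ℝ ∞ g) (hgc : HasCompactSupport g) {f : L2Plus}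
    (hf : f =ᵐ[volume.restrict (Set.Ioi (0 : ℝ))] testFun g) :
    ⟪f, H f⟫_ℂ = ((∫ x : ℝ, s₀ x * ‖invPhi (gammaMul g) x‖ ^ 2 : ℝ) : ℂ) := by
  have hγ := contDiff_gammaMul hg
  have hγc := hasCompactSupport_gammaMul hgc
  have hcorr := contDiff_autocorr hγ hγc
  have hcorrc := hasCompactSupport_autocorr hγc
  have htest : testFun g = Uinv (invPhiZ g hg hgc : 𝓢(ℝ, ℂ)) := by
    simp only [testFun, ← invPhiZ_apply hg hgc]
  have hinner : ⟪f, H f⟫_ℂ = s.toFun (invPhiZ _ hcorr hcorrc) := by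
    rw [← apply_invPhiZ_inv_Gamma_mul hs hcorr hcorrc]
    refine hH (invPhiZ g hg hgc) (invPhiZ g hg hgc) f f (htest ▸ hf) (htest ▸ hf) _ fun x => ?_
    rw [invPhiZ_apply, ← htest, laplaceConv_testFun hg hgc]
  rw [hinner, hs₀, ← integral_complex_ofReal]
  refine integral_congr_ae (ae_of_all _ fun x => ?_)
  simp only [invPhiZ_apply, ← conj_invPhi_mul_invPhi hγ.continuous hγc, Complex.conj_mul',
    Complex.ofReal_mul, Complex.ofReal_pow, map_pow, Complex.conj_ofReal]

theorem exists_re_inner_le_mul_norm_laplace_sq (hH : IsHankelOperator H θ)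
    (hs : IsSignFunctionOf θ s) (hpos : IsBoundedPositive s) : ∃ C : ℝ, ∀ f : L2Plus,
      (⟪f, H f⟫_ℂ).im = 0 ∧ 0 ≤ (⟪f, H f⟫_ℂ).re ∧ (⟪f, H f⟫_ℂ).re ≤ C * ‖laplace f‖ ^ 2 := by
  obtain ⟨s₀, -, hnonneg, ⟨C, hC⟩, hs₀⟩ := hpos
  refine ⟨C, fun f => dense_testSpace.induction (P := fun f : L2Plus => (⟪f, H f⟫_ℂ).im = 0 ∧
    0 ≤ (⟪f, H f⟫_ℂ).re ∧ (⟪f, H f⟫_ℂ).re ≤ C * ‖laplace f‖ ^ 2) ?_ ?_ f⟩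
  · rintro f ⟨g, hg, hgc, hf⟩
    have hnonneg' : ∀ᵐ x : ℝ, 0 ≤ s₀ x * ‖invPhi (gammaMul g) x‖ ^ 2 := by
      filter_upwards [hnonneg] with x hx
      positivity
    have hmem := memLp_invPhi (contDiff_gammaMul hg) (hasCompactSupport_gammaMul hgc)
    rw [inner_apply_of_ae_eq_testFun hH hs hs₀ hg hgc hf, Complex.ofReal_im, Complex.ofReal_re,
      norm_laplace_sq_of_ae_eq_testFun hg.continuous hgc hf, ← integral_const_mul]
    refine ⟨rfl, integral_nonneg_of_ae hnonneg', integral_mono_of_nonneg hnonneg'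
      (((memLp_two_iff_integrable_sq_norm hmem.1).1 hmem).const_mul C) ?_⟩
    filter_upwards [hC] with x hx
    exact mul_le_mul_of_nonneg_right hx (by positivity)
  · have hinner : Continuous fun f : L2Plus => ⟪f, H f⟫_ℂ := by fun_prop
    have hre := Complex.continuous_re.comp hinner
    have him := Complex.continuous_im.comp hinner
    exact (isClosed_eq him continuous_const).inter
      ((isClosed_le continuous_const hre).inter (isClosed_le hre (by fun_prop)))

lemma FiniteRankKernel.disjoint_range_range_laplace (k : FiniteRankKernel)
    {V : L2Plus →L[ℂ] L2Plus} (hV : IsHankelIntegralOperator V k.kernel) :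
    Disjoint (V : L2Plus →ₗ[ℂ] L2Plus).range (laplace : L2Plus →ₗ[ℂ] L2Plus).range := by
  rw [Submodule.disjoint_def]
  rintro _ hmem ⟨g, rfl⟩
  rw [k.eq_zero_of_laplace_mem_rangeSpan laplace_injective (k.range_le_rangeSpan hV hmem),
    map_zero]

end HankelSign

open HankelSign in
theorem theorem3
    (H₀ V : L2Plus →L[ℂ] L2Plus)
    (θ₀ s₀ : ZDual)
    (hH₀ : IsHankelOperator H₀ θ₀)
    (hs₀ : IsSignFunctionOf θ₀ s₀)
    (hpos : IsBoundedPositive s₀)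
    (k : FiniteRankKernel)
    (hV : IsHankelIntegralOperator V k.kernel) :
    IsSelfAdjoint V ∧ IsSelfAdjoint (H₀ + V) ∧
      Nminus (H₀ + V) = (k.totalNeg : ℕ∞) ∧
      Nminus (H₀ + V) = Nminus V ∧
      ((H₀ + V).IsPositive ↔ V.IsPositive) := by
  obtain ⟨C, hC⟩ := exists_re_inner_le_mul_norm_laplace_sq hH₀ hs₀ hpos
  have hH₀sa : IsSelfAdjoint H₀ := isSelfAdjoint_of_im_inner_eq_zero fun f => (hC f).1
  have hVsa : IsSelfAdjoint V := k.isSelfAdjoint hV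
  have hsum : IsSelfAdjoint (H₀ + V) := hH₀sa.add hVsa
  have hNV : Nminus V = k.totalNeg := k.nminus_eq hV
  have hle : Nminus (H₀ + V) ≤ k.totalNeg := k.nminus_add_le hV hH₀sa fun f => (hC f).2.1
  have hge : Nminus V ≤ Nminus (H₀ + V) := by
    have := k.finiteDimensional_range hV
    refine nminus_le_nminus_add hH₀sa hVsa laplace (fun f => (hC f).2.2) ?_
    rw [isSelfAdjoint_laplace.adjoint_eq]
    exact k.disjoint_range_range_laplace hV
  have hN : Nminus (H₀ + V) = Nminus V := le_antisymm (hle.trans_eq hNV.symm) hge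
  refine ⟨hVsa, hsum, hN.trans hNV, hN, ?_⟩
  rw [isPositive_iff_nminus_eq_zero hsum, isPositive_iff_nminus_eq_zero hVsa, hN]
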